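/- **Setting.** All parameters $k,s,t,u,w,N,N_{\mathrm{iter}}$ are functions of $n\in\mathbb N$ with $k\le n$, $s\le n$, $u\le t$, $u\le n-s$. Let $\mathbf e\in\mathbb F_2^n$ have Hamming weight $t$, let $\mathscr C=\{\mathbf c:\mathbf H\mathbf c^{\top}=0\}$ for an $(n-k)\times n$ binary matrix $\mathbf H$, let $\mathscr C^{\perp}$ be its dual (the set of parity-checks of $\mathscr C$), and let $\mathbf y=\mathbf c+\mathbf e$ with $\mathbf c\in\mathscr C$ be the received word. For a set $\mathscr P$ of $s$ positions with complement $\mathscr N$, write $\mathbf x_{\mathscr P},\mathbf x_{\mathscr N}$ for restrictions. Put $$K_w^{m}(x)=\sum_{j=0}^{w}(-1)^j\binom{x}{j}\binom{m-x}{w-j},\qquad \delta=\frac{K_w^{n-s}(u)}{\binom{n-s}{w}},\qquad P_{\mathrm{succ}}=\frac{\binom{s}{t-u}\binom{n-s}{u}}{\binom nt}.$$ **The RLPN decoder.** It performs at most $N_{\mathrm{iter}}$ iterations. Each iteration draws a uniform set $\mathscr P$ of $s$ positions, calls a routine $\mathrm{Create}(N,w,\mathscr P)$ which writes $N$ different parity-checks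 $\mathbf h\in\mathscr C^\perp$ with $|\mathbf h_{\mathscr N}|=w$, and forms the $N$ samples $(\mathbf a_i,b_i)=(\mathbf h_{\mathscr P},\langle\mathbf y,\mathbf h\rangle)$, in which the same $\mathbf a$ may occur several times. With $p'_i=\frac{1-\delta}2$ if $b_i=0$ and $p'_i=\frac{1+\delta}2$ if $b_i=1$, it computes $$p(\mathbf a)=\frac{\prod_{i:\mathbf a_i=\mathbf a}p'_i}{\prod_{i:\mathbf a_i=\mathbf a}p'_i+\prod_{i:\mathbf a_i=\mathbf a}(1-p'_i)},\qquad f(\mathbf a)=\begin{cases}\log\frac{1-p(\mathbf a)}{p(\mathbf a)}&\text{if }\mathbf a\text{ occurs among the }\mathbf a_i,\\0&\text{otherwise,}\end{cases}$$ the fast Fourier transform $\widehat f(\mathbf x)=\sum_{\mathbf a\in\mathbb F_2^s}f(\mathbf a)(-1)^{\langle\mathbf x,\mathbf a\rangle}$, and a maximizer $\mathbf x_0$ of $\widehat f$. If $\widehat f(\mathbf x_0)\ge\frac{\delta N}{2}\log\frac{1+\delta}{1-\delta}$, it stops and outputs $\mathscr P$ and $\mathbf x_0$ (as the candidate for $\mathbf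 e_{\mathscr P}$); otherwise it goes on to the next iteration. Costs are counted on a unit-cost random access machine with real-valued cells; time is the number of steps and space is the number of cells that are accessed. Assume that each call of Create takes time at most $T_{\mathrm{eq}}$ and that all the calls work within one set of $S_{\mathrm{eq}}$ cells, their output (all $Nn$ coordinates are accessed) included. **Claim.** 1. The probability over a uniform $\mathscr P$ that $|\mathbf e_{\mathscr N}|=u$ equals $P_{\mathrm{succ}}$. 2. The decoder program does what is described above: on any $N$ samples an iteration returns a maximizer of $\widehat f$ if the maximum reaches the threshold, and nothing otherwise; and the samples used in the iterations are LPN samples $(\mathbf h_{\mathscr P},\langle\mathbf e_{\mathscr P},\mathbf h_{\mathscr P}\rangle+\langle\mathbf e_{\mathscr N},\mathbf h_{\mathscr N}\rangle)$ with parity-checks $\mathbf h$ as above. 3. For $n,N\ge1$ and all codes, received words, sets $\mathscr P$ and admissible routines Create, the space and the time of the decoder are $$S=O\left(S_{\mathrm{eq}}+2^s\right),\qquad T=O\left(N_{\mathrm{iter}}\left(T_{\mathrm{eq}}+(s+1)2^s\right)\right).$$ Consequently, if $N\ge 1$ and $P_{\mathrm{succ}}>0$ for all large $n$, and $N_{\mathrm{iter}}=\frac1{P_{\mathrm{succ}}}$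 up to a factor at most polylogarithmic in $\frac{T_{\mathrm{eq}}+2^s}{P_{\mathrm{succ}}}$ (as an upper bound), then $$T=\widetilde O\left(\frac{T_{\mathrm{eq}}+2^s}{P_{\mathrm{succ}}}\right),$$ where $\widetilde O(g)$ means $O(g\log^a g)$ for some $a$. 4. Let $\mathbf H$ be uniformly random, and assume the LPN model: given the code, the iterations are independent, and given $\mathscr P$ the $N$ samples of an iteration are independent, each being $(\mathbf a,\langle\mathbf a,\mathbf e_{\mathscr P}\rangle+\eta)$ with $\mathbf a$ uniform in $\mathbb F_2^s$ and $\eta$ an independent Bernoulli variable of parameter $\frac{1-\varepsilon}2$, where $\varepsilon=\Pr(\langle\mathbf e_{\mathscr N},\mathbf h_{\mathscr N}\rangle=0)-\Pr(\langle\mathbf e_{\mathscr N},\mathbf h_{\mathscr N}\rangle=1)$ for $\mathbf h$ uniform among the parity-checks of $\mathscr C$ with $|\mathbf h_{\mathscr N}|=w$ ($\varepsilon=0$ if there are none). If, for all large $n$, $|\delta|<1$ and $$N\le\frac{\binom{n-s}{w}}{2^{k-s}},$$ and if $$N=\omega\left(n\left(\frac{\binom{n-s}{w}}{K_w^{n-s}(u)}\right)^2\right)\quad\text{and}\quad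 N_{\mathrm{iter}}=\omega\left(\frac1{P_{\mathrm{succ}}}\right),$$ then the probability (over the code, the sets $\mathscr P$ and the samples) that the decoder outputs a set $\mathscr P$ together with the correct $\mathbf e_{\mathscr P}$ is $1-o(1)$ as $n\to\infty$. -/

import Mathlib

namespace RLPN

noncomputable section

/-! ### Codes and parity-checks -/

/-- The code `{c : H cᵀ = 0}` with parity-check matrix `H`. -/
def code {m n : ℕ} (H : Matrix (Fin m) (Fin n) (ZMod 2)) : Set (Fin n → ZMod 2) :=
  {c | H.mulVec c = 0}

/-- The dual code: the parity-checks of `C`. -/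
def dual {n : ℕ} (C : Set (Fin n → ZMod 2)) : Set (Fin n → ZMod 2) :=
  {d | ∀ c ∈ C, dotProduct c d = 0}

/-- The sets `𝒫` of `s` positions among `n`. -/
abbrev Pos (n s : ℕ) : Type := {P : Finset (Fin n) // P.card = s}

/-- The `s`-bit words, i.e. the elements of `𝔽₂ˢ`. -/
abbrev Word (s : ℕ) : Type := Fin s → ZMod 2

/-- The position number `l` of `𝒫`, in increasing order. -/
def position {n s : ℕ} (P : Pos n s) (l : Fin s) : Fin n := P.1.orderEmbOfFin P.2 l

/-- The restriction `x_𝒫`. -/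
def onP {n s : ℕ} (P : Pos n s) (x : Fin n → ZMod 2) : Word s := fun l => x (position P l)

/-- The Hamming weight `|x_𝒩|` where `𝒩` is the complement of `𝒫`. -/
def weightN {n s : ℕ} (P : Pos n s) (x : Fin n → ZMod 2) : ℕ :=
  ((P.1)ᶜ.filter fun j => x j ≠ 0).card

/-- The scalar product `⟨x_𝒩, h_𝒩⟩`. -/
def dotN {n s : ℕ} (P : Pos n s) (x h : Fin n → ZMod 2) : ZMod 2 :=
  ∑ j ∈ (P.1)ᶜ, x j * h j

/-- `Pr(g(h) = 0) - Pr(g(h) = 1)` for `h` uniform in the finite set `S`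
(and `0` if `S` is empty). -/
def bias {α : Type} (S : Finset α) (g : α → ZMod 2) : ℝ :=
  (((S.filter fun h => g h = 0).card : ℝ) - ((S.filter fun h => g h = 1).card : ℝ)) / (S.card : ℝ)

open Classical in
/-- The parity-checks `h` of `C` such that `|h_𝒩| = w`. -/
def checks {n s : ℕ} (C : Set (Fin n → ZMod 2)) (w : ℕ) (P : Pos n s) :
    Finset (Fin n → ZMod 2) :=
  Finset.univ.filter fun h => h ∈ dual C ∧ weightN P h = w

/-- The bias `ε` of the LPN samples: the bias of `⟨e_𝒩, h_𝒩⟩` for `h` uniform among the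
parity-checks of `C` of weight `w` on `𝒩`. -/
def lpnBias {n s : ℕ} (C : Set (Fin n → ZMod 2)) (w : ℕ) (e : Fin n → ZMod 2) (P : Pos n s) : ℝ :=
  bias (checks C w P) (dotN P e)

/-- The Krawtchouk polynomial `K_w^n` at an integer `0 ≤ x ≤ n`. -/
def krawtchouk (n w x : ℕ) : ℝ :=
  ∑ j ∈ Finset.range (w + 1), (-1 : ℝ) ^ j * (x.choose j : ℝ) * ((n - x).choose (w - j) : ℝ)

/-- The estimated bias `δ = K_w^{n-s}(u) / C(n-s, w)`. -/
def estBias (n s u w : ℕ) : ℝ := krawtchouk (n - s) w u / ((n - s).choose w : ℝ)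

/-- `P_succ = C(s, t-u) C(n-s, u) / C(n, t)` (for `u ≤ t`). -/
def pSucc (n s t u : ℕ) : ℝ :=
  ((s.choose (t - u) : ℝ) * ((n - s).choose u : ℝ)) / (n.choose t : ℝ)

/-- `f = ω(g)`. -/
def IsOmega (f g : ℕ → ℝ) : Prop :=
  Filter.Tendsto (fun n => |f n| / g n) Filter.atTop Filter.atTop

/-! ### The log-likelihood function of a list of LPN samples -/

/-- An LPN sample `(a, b)`, where `b` is a noisy version of `⟨a, secret⟩`. -/
abbrev Sample (s : ℕ) : Type := Word s × ZMod 2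

/-- The samples with secret `x`, vectors `a i` and noise `η i`. -/
def lpnSamples {s N : ℕ} (x : Word s) (a : Fin N → Word s) (η : Fin N → ZMod 2) :
    Fin N → Sample s :=
  fun i => (a i, dotProduct x (a i) + η i)

/-- `p'ᵢ`: the noise probability `(1-δ)/2` if the sample bit is `0`, and `1` minus it otherwise. -/
def pFlip (δ : ℝ) (b : ZMod 2) : ℝ := if b = 0 then (1 - δ) / 2 else 1 - (1 - δ) / 2

/-- The probability `p(a)` that `⟨a, secret⟩ = 1` given all the samples with this same `a`. -/
def pOne {s N : ℕ} (δ : ℝ) (smp : Fin N → Sample s) (a : Word s) : ℝ :=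
  (∏ i with (smp i).1 = a, pFlip δ (smp i).2) /
    ((∏ i with (smp i).1 = a, pFlip δ (smp i).2) +
      ∏ i with (smp i).1 = a, (1 - pFlip δ (smp i).2))

open Classical in
/-- The log-likelihood function `f`. -/
def llr {s N : ℕ} (δ : ℝ) (smp : Fin N → Sample s) (a : Word s) : ℝ :=
  if ∃ i, (smp i).1 = a then Real.log ((1 - pOne δ smp a) / pOne δ smp a) else 0

/-- The Fourier transform on `𝔽₂ˢ`. -/
def fourier {s : ℕ} (f : Word s → ℝ) (x : Word s) : ℝ :=
  ∑ a, f a * (-1 : ℝ) ^ (dotProduct x a).val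

/-- The acceptance threshold: `δ N / 2`, in the scale of the log-likelihood function, in which
each sample counts for `± log ((1+δ)/(1-δ))` instead of `± 1`. -/
def threshold (δ : ℝ) (N : ℕ) : ℝ := δ * N / 2 * Real.log ((1 + δ) / (1 - δ))

/-- What one iteration has to return on given samples: a maximizer `x₀` of the Fourier transform
of `f` if the maximum reaches the threshold, and nothing otherwise. -/
def IterSpec {s N : ℕ} (δ : ℝ) (smp : Fin N → Sample s) (r : Option (Word s)) : Prop :=
  (r = none ∧ ∀ x, fourier (llr δ smp) x < threshold δ N) ∨
  ∃ x₀, r = some x₀ ∧ (∀ x, fourier (llr δ smp) x ≤ fourier (llr δ smp) x₀) ∧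
    threshold δ N ≤ fourier (llr δ smp) x₀

/-! ### Machine model

A random access machine with unit cost: the cells hold real numbers, and reading a cell, writing a
cell, and an operation on a bounded number of registers (arithmetic, logarithm, comparison, address
computation) take one step each. -/

/-- The addresses, organized in disjoint arrays. -/
inductive Cell (s : ℕ) : Type
  /-- received word -/
  | inp (j : ℕ)
  /-- parity-check matrix of the code -/
  | mat (i j : ℕ)
  /-- the chosen positions -/
  | pos (l : ℕ)
  /-- coordinate `j` of the parity-check number `i` -/
  | chk (i j : ℕ)
  /-- bit `l` of the vector `a` of the sample number `i` -/
  | smpA (i : ℕ) (l : Fin s)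
  /-- second component of the sample number `i` -/
  | smpB (i : ℕ)
  /-- product of the `p'ᵢ` -/
  | num (x : Word s)
  /-- product of the `1 - p'ᵢ` -/
  | den (x : Word s)
  /-- the vector on which the fast Fourier transform is performed in place -/
  | tab (x : Word s)
  /-- scratch memory -/
  | scr (z : ℕ)

abbrev Mem (s : ℕ) : Type := Cell s → ℝ

/-- Programs. -/
inductive Prog (s : ℕ) (α : Type) : Type
  | ret (a : α) : Prog s α
  | read (c : Cell s) (k : ℝ → Prog s α) : Prog s α
  | write (c : Cell s) (v : ℝ) (k : Prog s α) : Prog s α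
  | tick (k : Prog s α) : Prog s α

namespace Prog

variable {s : ℕ} {α β ι : Type}

def bind : Prog s α → (α → Prog s β) → Prog s β
  | ret a, f => f a
  | read c k, f => read c fun v => bind (k v) f
  | write c v k, f => write c v (bind k f)
  | tick k, f => tick (bind k f)

instance : Monad (Prog s) where
  pure := ret
  bind := bind

open Classical in
/-- Result and final memory. -/
def run : Prog s α → Mem s → α × Mem s
  | ret a, m => (a, m)
  | read c k, m => run (k (m c)) m
  | write c v k, m => run k (Function.update m c v)
  | tick k, m => run k m

open Classical in
/-- Number of steps. -/
def time : Prog s α → Mem s → ℕ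
  | ret _, _ => 0
  | read c k, m => time (k (m c)) m + 1
  | write c v k, m => time k (Function.update m c v) + 1
  | tick k, m => time k m + 1

open Classical in
/-- The set of cells that are read or written. -/
def cells : Prog s α → Mem s → Finset (Cell s)
  | ret _, _ => ∅
  | read c k, m => insert c (cells (k (m c)) m)
  | write c v k, m => insert c (cells k (Function.update m c v))
  | tick k, m => cells k m

/-- A loop over a list, with a register. Each turn costs one step for the loop control. -/
def loop (l : List ι) (body : ι → β → Prog s β) (b : β) : Prog s β :=
  match l with
  | [] => ret b
  | i :: l => tick (bind (body i b) fun b' => loop l body b')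

def forEach (l : List ι) (body : ι → Prog s Unit) : Prog s Unit :=
  loop l (fun i _ => body i) ()

/-- Read the cell `c`. -/
def rd (c : Cell s) : Prog s ℝ := read c ret
/-- Write the value `v`, obtained by one operation on registers, in the cell `c`. -/
def wr (c : Cell s) (v : ℝ) : Prog s Unit := tick (write c v (ret ()))
/-- Return a value obtained by one operation on registers. -/
def op (a : α) : Prog s α := tick (ret a)

end Prog

open Prog

/-- All the `s`-bit words. -/
def words (s : ℕ) : List (Word s) := (Finset.univ : Finset (Word s)).toList

/-- A bit as the content of a cell, and back. -/
def bit (b : ZMod 2) : ℝ := if b = 0 then 0 else 1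
def unbit (r : ℝ) : ZMod 2 := if r = 0 then 0 else 1

/-! ### The decoder -/

/-- Reads the vector `a` of the sample number `i`, bit by bit. -/
def readWord {s : ℕ} (i : ℕ) : Prog s (Word s) :=
  loop (List.finRange s) (fun l a => do
    let v ← rd (.smpA i l)
    op (Function.update a l (unbit v))) 0

/-- Computes the vector `f` from the `N` samples in memory. A word `a` that occurs in no sample has
two empty products, hence `p(a) = 1/2` and `f(a) = log 1 = 0`. -/
def buildTable (s N : ℕ) (δ : ℝ) : Prog s Unit := do
  forEach (words s) fun x => do
    wr (.num x) 1
    wr (.den x) 1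
  forEach (List.finRange N) fun i => do
    let a ← readWord i
    let b ← rd (.smpB i)
    let p ← op (pFlip δ (unbit b))
    let v ← rd (.num a)
    wr (.num a) (v * p)
    let q ← op (1 - p)
    let v' ← rd (.den a)
    wr (.den a) (v' * q)
  forEach (words s) fun x => do
    let v ← rd (.num x)
    let v' ← rd (.den x)
    let d ← op (v + v')
    let p ← op (v / d)
    let q ← op (1 - p)
    let r ← op (q / p)
    wr (.tab x) (Real.log r)

/-- The in-place fast Fourier transform of the vector `tab`. -/
def fft (s : ℕ) : Prog s Unit :=
  forEach (List.finRange s) fun l =>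
    forEach (words s) fun x =>
      if x l = 0 then do
        let x' ← op (Function.update x l 1)
        let v ← rd (.tab x)
        let v' ← rd (.tab x')
        wr (.tab x) (v + v')
        wr (.tab x') (v - v')
      else op ()

/-- A word where `tab` is maximal, with the maximum. -/
def argmax (s : ℕ) : Prog s (Word s × ℝ) := do
  let v₀ ← rd (.tab 0)
  loop (words s) (fun x best => do
    let v ← rd (.tab x)
    op (if best.2 < v then (x, v) else best)) (0, v₀)

/-- The second half of an iteration: solves the LPN problem given by the `N` samples in memory. -/
def solve (s N : ℕ) (δ : ℝ) : Prog s (Option (Word s)) := do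
  buildTable s N δ
  fft s
  let best ← argmax s
  op (if threshold δ N ≤ best.2 then some best.1 else none)

/-- The outer loop. Each entry of the list is one iteration: a set `𝒫`, and a program that puts
`N` samples in the memory. The output is the set `𝒫` of the first iteration which is accepted,
together with the candidate `x₀` for `e_𝒫`. -/
def decoder {n s : ℕ} (N : ℕ) (δ : ℝ) :
    List (Pos n s × Prog s Unit) → Prog s (Option (Pos n s × Word s))
  | [] => ret none
  | (P, source) :: rest => do
    source
    let r ← solve s N δ
    match r with
    | some x₀ => op (some (P, x₀))
    | none => tick (decoder N δ rest)

/-- Puts the given samples in the memory. -/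
def load {s N : ℕ} (smp : Fin N → Sample s) : Prog s Unit :=
  forEach (List.finRange N) fun i => do
    forEach (List.finRange s) fun l => wr (.smpA i l) (bit ((smp i).1 l))
    wr (.smpB i) (bit (smp i).2)

/-- The first half of an iteration with the set `𝒫`: writes `𝒫`, calls the routine `create` which
writes `N` parity-checks `h`, and computes the LPN samples `(h_𝒫, ⟨y, h⟩)`. The choice of `𝒫` is
charged `n` steps on top of the writing. -/
def source {n s : ℕ} (N : ℕ) (P : Pos n s) (create : Prog s Unit) : Prog s Unit := do
  forEach (List.finRange n) fun _ => op ()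
  forEach (List.finRange s) fun l => wr (.pos l) ((position P l : ℕ) : ℝ)
  create
  forEach (List.finRange N) fun i => do
    forEach (List.finRange s) fun l => do
      let v ← rd (.pos l)
      let h ← rd (.chk i ⌊v⌋₊)
      wr (.smpA i l) h
    let b ← loop (List.finRange n) (fun j b => do
      let h ← rd (.chk i (j : ℕ))
      let v ← rd (.inp (j : ℕ))
      op (b + unbit h * unbit v)) (0 : ZMod 2)
    wr (.smpB i) (bit b)

/-- The memory holds the received word `y` and the parity-check matrix `H`. -/
def InputLoaded {n m s : ℕ} (y : Fin n → ZMod 2) (H : Matrix (Fin m) (Fin n) (ZMod 2))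
    (M : Mem s) : Prop :=
  (∀ j : Fin n, M (.inp j) = bit (y j)) ∧ ∀ (i : Fin m) (j : Fin n), M (.mat i j) = bit (H i j)

/-- The memory holds the set `𝒫`. -/
def PosLoaded {n s : ℕ} (P : Pos n s) (M : Mem s) : Prop :=
  ∀ l : Fin s, M (.pos l) = ((position P l : ℕ) : ℝ)

/-- The memory holds the vectors `h i`, `i < N`. -/
def ChecksLoaded {n s N : ℕ} (h : Fin N → Fin n → ZMod 2) (M : Mem s) : Prop :=
  ∀ (i : Fin N) (j : Fin n), M (.chk i j) = bit (h i j)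

/-- The `N` vectors `h i` are different parity-checks of weight `w` on `𝒩` of the code. -/
def AreChecks {n s N : ℕ} (C : Set (Fin n → ZMod 2)) (w : ℕ) (P : Pos n s)
    (h : Fin N → Fin n → ZMod 2) : Prop :=
  Function.Injective h ∧ ∀ i, h i ∈ checks C w P

/-- `create` produces `N` parity-checks of weight `w` on `𝒩` of the code with parity-check matrix
`H`, in time at most `Teq` and within the set `W` of cells (its output being part of these cells),
and leaves its input unchanged. A randomized routine is one such program for each outcome of its
random choices. -/
def IsCreate {n m s : ℕ} (y : Fin n → ZMod 2) (H : Matrix (Fin m) (Fin n) (ZMod 2)) (N w : ℕ)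
    (Teq : ℕ) (W : Finset (Cell s)) (P : Pos n s) (create : Prog s Unit) : Prop :=
  ∀ M : Mem s, InputLoaded y H M → PosLoaded P M →
    create.time M ≤ Teq ∧ create.cells M ⊆ W ∧
    (∀ (i : Fin N) (j : Fin n), Cell.chk (i : ℕ) (j : ℕ) ∈ create.cells M) ∧
    InputLoaded y H (create.run M).2 ∧ PosLoaded P (create.run M).2 ∧
    ∃ h : Fin N → Fin n → ZMod 2, AreChecks (code H) w P h ∧ ChecksLoaded h (create.run M).2

/-- The decoder with `Niter` iterations, given the sets and the calls of `create`. -/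
def rlpn {n s Niter : ℕ} (N : ℕ) (δ : ℝ) (P : Fin Niter → Pos n s)
    (create : Fin Niter → Prog s Unit) : Prog s (Option (Pos n s × Word s)) :=
  decoder N δ (List.ofFn fun j => (P j, source N (P j) (create j)))

/-- The decoder with `Niter` iterations, run on given samples. -/
def rlpnOn {n s N Niter : ℕ} (δ : ℝ) (it : Fin Niter → Pos n s × (Fin N → Sample s)) :
    Prog s (Option (Pos n s × Word s)) :=
  decoder N δ (List.ofFn fun j => ((it j).1, load (it j).2))

/-- Everything that one execution of the decoder is about: a code given by an `(n-k) × n`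
parity-check matrix, a received word `c + e`, the sets of positions, the calls of `create` (each
in time at most `Teq`, all of them within `Seq` cells), and the initial memory. -/
def IsExecution {n s Niter : ℕ} (k N w : ℕ) (Seq Teq : ℕ) (e : Fin n → ZMod 2)
    (H : Matrix (Fin (n - k)) (Fin n) (ZMod 2)) (c : Fin n → ZMod 2) (P : Fin Niter → Pos n s)
    (create : Fin Niter → Prog s Unit) (W : Finset (Cell s)) (M : Mem s) : Prop :=
  c ∈ code H ∧ W.card ≤ Seq ∧ (∀ j, IsCreate (c + e) H N w Teq W (P j) (create j)) ∧
    InputLoaded (c + e) H M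

/-! ### The probabilistic model -/

/-- The law of `m` independent draws from `p`. -/
def iid {α : Type} (p : PMF α) : (m : ℕ) → PMF (Fin m → α)
  | 0 => PMF.pure Fin.elim0
  | m + 1 => p.bind fun a => (iid p m).map fun v => (Fin.cons a v : Fin (m + 1) → α)

/-- A uniform set of `s` positions among `n`. -/
def uniformPos {n s : ℕ} (hs : s ≤ n) : PMF (Pos n s) :=
  haveI : Nonempty (Pos n s) := by
    obtain ⟨P, -, hP⟩ := Finset.exists_subset_card_eq
      (s := (Finset.univ : Finset (Fin n))) (n := s) (by simpa using hs)
    exact ⟨⟨P, hP⟩⟩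
  PMF.uniformOfFintype (Pos n s)

theorem abs_bias_le_one {α : Type} (S : Finset α) (g : α → ZMod 2) : |bias S g| ≤ 1 := by
  have h : (S.filter fun h => g h = 0).card ≤ S.card := Finset.card_filter_le _ _
  have h' : (S.filter fun h => g h = 1).card ≤ S.card := Finset.card_filter_le _ _
  have h1 : ((S.filter fun h => g h = 0).card : ℝ) ≤ S.card := by exact_mod_cast h
  have h2 : ((S.filter fun h => g h = 1).card : ℝ) ≤ S.card := by exact_mod_cast h'
  have h3 : (0 : ℝ) ≤ ((S.filter fun h => g h = 0).card : ℝ) := Nat.cast_nonneg _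
  have h4 : (0 : ℝ) ≤ ((S.filter fun h => g h = 1).card : ℝ) := Nat.cast_nonneg _
  unfold bias
  rw [abs_div, abs_of_nonneg (Nat.cast_nonneg (α := ℝ) S.card)]
  apply div_le_one_of_le₀ _ (Nat.cast_nonneg _)
  rw [abs_le]
  constructor <;> linarith

/-- The Bernoulli law of bias `ε`, i.e. of parameter `Pr(1) = (1-ε)/2`. -/
def bernoulliBias (ε : ℝ) (hε : |ε| ≤ 1) : PMF (ZMod 2) :=
  PMF.ofFintype
    (fun b => if b = 0 then ENNReal.ofReal ((1 + ε) / 2) else ENNReal.ofReal ((1 - ε) / 2)) (by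
    obtain ⟨h1, h2⟩ := abs_le.1 hε
    have h : ∀ f : ZMod 2 → ENNReal, ∑ b, f b = f 0 + f 1 := fun f => Fin.sum_univ_two f
    rw [h, if_pos rfl, if_neg (by decide),
      ← ENNReal.ofReal_add (by linarith) (by linarith)]
    rw [show (1 + ε) / 2 + (1 - ε) / 2 = 1 by ring, ENNReal.ofReal_one])

/-- The LPN oracle with secret `x` and noise of bias `ε`: a sample `(a, ⟨x, a⟩ + η)` with `a`
uniform and `η` an independent Bernoulli variable. -/
def lpnOracle {s : ℕ} (x : Word s) (ε : ℝ) (hε : |ε| ≤ 1) : PMF (Sample s) :=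
  (PMF.uniformOfFintype (Word s)).bind fun a =>
    (bernoulliBias ε hε).map fun η => (a, dotProduct x a + η)

/-- One iteration in the LPN model: a uniform set `𝒫`, and `N` independent samples of the LPN
oracle with secret `e_𝒫`, the bias of the noise being that of `⟨e_𝒩, h_𝒩⟩` for `h` uniform among
the parity-checks of the code of weight `w` on `𝒩`. -/
def iteration {n s : ℕ} (hs : s ≤ n) (N w : ℕ) (e : Fin n → ZMod 2) (C : Set (Fin n → ZMod 2)) :
    PMF (Pos n s × (Fin N → Sample s)) :=
  (uniformPos hs).bind fun P =>
    (iid (lpnOracle (onP P e) (lpnBias C w e P) (abs_bias_le_one _ _)) N).map fun smp => (P, smp)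

/-- The law of the `Niter` iterations of the decoder, independent given the code, for a code chosen
by picking an `(n-k) × n` parity-check matrix uniformly at random. -/
def experiment {n s : ℕ} (hs : s ≤ n) (k N w Niter : ℕ) (e : Fin n → ZMod 2) :
    PMF (Fin Niter → Pos n s × (Fin N → Sample s)) :=
  (PMF.uniformOfFintype (Matrix (Fin (n - k)) (Fin n) (ZMod 2))).bind fun H =>
    iid (iteration hs N w e (code H)) Niter

/-- The output is the restriction of `e` to the set of positions that goes with it. -/
def IsCorrect {n s : ℕ} (e : Fin n → ZMod 2) (r : Option (Pos n s × Word s)) : Prop :=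
  ∃ P : Pos n s, r = some (P, onP P e)

end

end RLPN

namespace RLPN

noncomputable section

open Prog

/-! ### Program logic -/

namespace Prog

variable {s : ℕ} {α β ι : Type}

/-! Semantics and cost. A Hoare-style triple `Does` records at once the postcondition, a time bound
and a set containing all accessed cells. Cells outside this set are unchanged, so the input survives
from one iteration to the next. The passes of the fast Fourier transform compute the transform with
respect to more and more coordinates (`partialFourier_insert`). Since c is orthogonal to h, the bit
⟨y,h⟩ equals ⟨e,h⟩, which splits over 𝒫 and 𝒩 into an LPN sample. An iteration costs O(Nn +
(s+1)2^s) besides the call of `create`, and Nn is at most both `Teq` and the size of the work space,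
because the Nn output cells are distinct and all accessed (`card_checks_le`).

Success probability. Samples with equal a add up in the log-likelihood, so the Fourier transform at
x is log((1+δ)/(1-δ)) times the sum of the signs (-1)^(⟨x,a_i⟩+b_i) (`fourier_llr`), and acceptance
means δ·Σ ≥ δ²N/2. For x ≠ e_𝒫 the signs are unbiased whatever 𝒫 and the code are. A Chernoff bound
and a union bound over 2^s words make a wrong acceptance have probability at most exp(-15n) once Nδ²
≥ 128n. For x = e_𝒫 the signs have mean ε, and a second Chernoff bound works as soon as δε ≥
(3/4)δ².

This last inequality is a property of the random code. The bias ε is a ratio B/A of sums over the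
words zH of the row space; for z ≠ 0 these are uniform and pairwise independent (`ex_vecMul_mul`).
When |e_𝒩| = u, character sums give the means δμ and μ, where μ ≥ N/2 by the upper bound on N, and
both variances are at most μ. Chebyshev's inequality bounds the probability of a bad ε by 200/(δ²μ)
(`ex_bad_bias_le`).

All iterations share the code, so the code is fixed first. By Markov's inequality, most codes have a
good ε for at least half of the sets 𝒫 with |e_𝒩| = u. For such a code one iteration succeeds with
probability at least P_succ/4 and errs with probability at most exp(-15n), and a recursion over the
iterations (`decoderVal_fail_le`) finishes, since 1/P_succ ≤ 2^n. -/

theorem bind_eq (p : Prog s α) (f : α → Prog s β) : (p >>= f) = Prog.bind p f := rfl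

theorem run_bind (p : Prog s α) (f : α → Prog s β) (m : Mem s) :
    (Prog.bind p f).run m = (f (p.run m).1).run (p.run m).2 := by
  induction p generalizing m with
  | ret a => rfl
  | read c k ih => exact ih _ _
  | write c v k ih => exact ih _
  | tick k ih => exact ih _

theorem time_bind (p : Prog s α) (f : α → Prog s β) (m : Mem s) :
    (Prog.bind p f).time m = p.time m + (f (p.run m).1).time (p.run m).2 := by
  induction p generalizing m with
  | ret a => simp [Prog.bind, time, run]
  | read c k ih => simp only [Prog.bind, time, run, ih]; omega
  | write c v k ih => simp only [Prog.bind, time, run, ih]; omega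
  | tick k ih => simp only [Prog.bind, time, run, ih]; omega

theorem mem_cells_bind (p : Prog s α) (f : α → Prog s β) (m : Mem s) (c : Cell s) :
    c ∈ (Prog.bind p f).cells m ↔
      c ∈ p.cells m ∨ c ∈ (f (p.run m).1).cells (p.run m).2 := by
  induction p generalizing m with
  | ret a => simp [Prog.bind, cells, run]
  | read c k ih => simp only [Prog.bind, cells, run, Finset.mem_insert, ih, or_assoc]
  | write c v k ih => simp only [Prog.bind, cells, run, Finset.mem_insert, ih, or_assoc]
  | tick k ih => simp only [Prog.bind, cells, run, ih]

theorem card_cells_le_time (p : Prog s α) (m : Mem s) : (p.cells m).card ≤ p.time m := by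
  classical
  induction p generalizing m with
  | ret a => simp [cells]
  | read c k ih => exact (Finset.card_insert_le _ _).trans (Nat.succ_le_succ (ih _ _))
  | write c v k ih => exact (Finset.card_insert_le _ _).trans (Nat.succ_le_succ (ih _))
  | tick k ih => exact (ih m).trans (Nat.le_succ _)

/-- Memory changes only by writes, and every write registers its cell. This is the source of the
frame rule `Does.frame`. -/
theorem run_apply_of_notMem_cells (p : Prog s α) (m : Mem s) {c : Cell s}
    (hc : c ∉ p.cells m) : (p.run m).2 c = m c := by
  classical
  induction p generalizing m with
  | ret a => rfl
  | read c' k ih =>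
    simp only [cells, Finset.mem_insert, not_or] at hc
    exact ih _ _ hc.2
  | write c' v k ih =>
    simp only [cells, Finset.mem_insert, not_or] at hc
    simp only [run]
    rw [ih _ hc.2, Function.update_of_ne hc.1]
  | tick k ih => exact ih m hc

/-- Started in the memory `m`, the program `p` makes at most `T` steps, accesses only cells of `W`,
and its result and final memory satisfy `post`. -/
structure Does (p : Prog s α) (m : Mem s) (T : ℕ) (W : Set (Cell s))
    (post : α → Mem s → Prop) : Prop where
  post : post (p.run m).1 (p.run m).2
  time : p.time m ≤ T
  cells : ∀ c ∈ p.cells m, c ∈ W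

variable {p : Prog s α} {m : Mem s} {T T' T₁ T₂ : ℕ} {W W' : Set (Cell s)}
  {post post' : α → Mem s → Prop}

theorem Does.mono (h : Does p m T W post) (hT : T ≤ T') (hW : W ⊆ W')
    (hpost : ∀ a m', post a m' → post' a m') : Does p m T' W' post' :=
  ⟨hpost _ _ h.1, h.2.trans hT, fun c hc => hW (h.3 c hc)⟩

theorem Does.imp (h : Does p m T W post) (hpost : ∀ a m', post a m' → post' a m') :
    Does p m T W post' :=
  h.mono le_rfl subset_rfl hpost

theorem Does.frame (h : Does p m T W post) :
    Does p m T W fun a m' => post a m' ∧ ∀ c ∉ W, m' c = m c :=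
  ⟨⟨h.1, fun c hc => run_apply_of_notMem_cells p m fun hc' => hc (h.3 c hc')⟩, h.2, h.3⟩

theorem Does.bind {f : α → Prog s β} {post' : β → Mem s → Prop} (h : Does p m T₁ W post)
    (hf : ∀ a m', post a m' → Does (f a) m' T₂ W post') :
    Does (p >>= f) m (T₁ + T₂) W post' := by
  have h' := hf _ _ h.1
  rw [bind_eq]
  refine ⟨?_, ?_, fun c hc => ?_⟩
  · rw [run_bind]; exact h'.1
  · rw [time_bind]; exact add_le_add h.2 h'.2
  · exact ((mem_cells_bind _ _ _ _).1 hc).elim (h.3 c) (h'.3 c)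

theorem Does.tick (h : Does p m T W post) : Does (tick p) m (T + 1) W post :=
  ⟨h.1, Nat.succ_le_succ h.2, h.3⟩

/-- The invariant is indexed by the prefix already treated. The step also receives the splitting of
the whole list, so that a proof may use that the list has no repetitions. -/
theorem Does.loop {l : List ι} {body : ι → β → Prog s β} {b : β} (I : List ι → β → Mem s → Prop)
    (hstep : ∀ done i rest, l = done ++ i :: rest → ∀ b m, I done b m →
      Does (body i b) m T W (I (done ++ [i])))
    (h0 : I [] b m) : Does (loop l body b) m (l.length * (T + 1)) W (I l) := by
  suffices H : ∀ rest done, l = done ++ rest → ∀ b m, I done b m →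
      Does (Prog.loop rest body b) m (rest.length * (T + 1)) W (I l) from H l [] rfl b m h0
  intro rest
  induction rest with
  | nil =>
    intro done hl b m hI
    rw [List.append_nil] at hl
    exact ⟨hl ▸ hI, by simp [Prog.loop, Prog.time], by simp [Prog.loop, Prog.cells]⟩
  | cons i rest ih =>
    intro done hl b m hI
    have := ((hstep done i rest hl b m hI).bind fun b' m' h' =>
      ih (done ++ [i]) (by simp [hl]) b' m' h').tick
    refine this.mono ?_ subset_rfl fun _ _ h => h
    simp only [List.length_cons]
    linarith

theorem Does.forEach {l : List ι} {body : ι → Prog s Unit} (I : List ι → Mem s → Prop)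
    (hstep : ∀ done i rest, l = done ++ i :: rest → ∀ m, I done m →
      Does (body i) m T W fun _ => I (done ++ [i]))
    (h0 : I [] m) : Does (forEach l body) m (l.length * (T + 1)) W fun _ => I l :=
  Does.loop (fun l _ => I l) (fun done i rest hl _ m => hstep done i rest hl m) h0

theorem Does.op {a : α} (h : post a m) : Does (op a) m 1 W post :=
  ⟨h, le_rfl, by simp [Prog.op, Prog.cells]⟩

theorem Does.rd {c : Cell s} {post : ℝ → Mem s → Prop} (hc : c ∈ W) (h : post (m c) m) :
    Does (rd c) m 1 W post :=
  ⟨h, le_rfl, by simpa [Prog.rd, Prog.cells] using hc⟩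

open Classical in
theorem Does.wr {c : Cell s} {v : ℝ} {post : Unit → Mem s → Prop} (hc : c ∈ W)
    (h : post () (Function.update m c v)) : Does (wr c v) m 2 W post :=
  ⟨h, le_rfl, by simpa [Prog.wr, Prog.cells] using hc⟩

theorem Does.rd_bind {c : Cell s} {f : ℝ → Prog s β} {post : β → Mem s → Prop} (hc : c ∈ W)
    (h : Does (f (m c)) m T W post) : Does (Prog.rd c >>= f) m (T + 1) W post := by
  rw [add_comm]
  exact (Does.rd (post := fun a m' => a = m c ∧ m' = m) hc ⟨rfl, rfl⟩).bind
    fun a m' h' => by rw [h'.1, h'.2]; exact h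

theorem Does.op_bind {a : α} {f : α → Prog s β} {post : β → Mem s → Prop}
    (h : Does (f a) m T W post) : Does (Prog.op a >>= f) m (T + 1) W post := by
  rw [add_comm]
  exact (Does.op (post := fun a' m' => a' = a ∧ m' = m) ⟨rfl, rfl⟩).bind
    fun a' m' h' => by rw [h'.1, h'.2]; exact h

open Classical in
theorem Does.wr_bind {c : Cell s} {v : ℝ} {f : Unit → Prog s β} {post : β → Mem s → Prop}
    (hc : c ∈ W) (h : Does (f ()) (Function.update m c v) T W post) :
    Does (Prog.wr c v >>= f) m (T + 2) W post := by
  rw [add_comm]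
  exact (Does.wr (post := fun _ m' => m' = Function.update m c v) hc rfl).bind
    fun a' m' h' => by rw [h']; exact h

end Prog

/-! ### Solving the LPN problem -/

theorem unbit_bit (b : ZMod 2) : unbit (bit b) = b := by
  have : b = 0 ∨ b = 1 := by revert b; decide
  rcases this with rfl | rfl <;> simp [bit, unbit]

theorem mem_words {s : ℕ} (x : Word s) : x ∈ words s := by simp [words]

theorem nodup_words (s : ℕ) : (words s).Nodup := Finset.nodup_toList _

theorem length_words (s : ℕ) : (words s).length = 2 ^ s := by
  simp [words, ZMod.card]

/-- The memory holds the samples. -/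
def SamplesLoaded {s N : ℕ} (smp : Fin N → Sample s) (m : Mem s) : Prop :=
  ∀ i : Fin N, (∀ l, m (.smpA i l) = bit ((smp i).1 l)) ∧ m (.smpB i) = bit (smp i).2

/-- The cells of the samples. -/
def sampleCells (s N : ℕ) : Set (Cell s) :=
  {c | (∃ i < N, ∃ l, c = .smpA i l) ∨ ∃ i < N, c = .smpB i}

/-- The cells of the vectors indexed by words. -/
def wordCells (s : ℕ) : Set (Cell s) :=
  {c | ∃ x, c = .num x ∨ c = .den x ∨ c = .tab x}

theorem smpA_mem {s N : ℕ} (i : Fin N) (l : Fin s) : Cell.smpA i l ∈ sampleCells s N :=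
  Or.inl ⟨i, i.2, l, rfl⟩

theorem smpB_mem {s N : ℕ} (i : Fin N) : (Cell.smpB i : Cell s) ∈ sampleCells s N :=
  Or.inr ⟨i, i.2, rfl⟩

theorem num_mem {s : ℕ} (x : Word s) : Cell.num x ∈ wordCells s := ⟨x, by simp⟩
theorem den_mem {s : ℕ} (x : Word s) : Cell.den x ∈ wordCells s := ⟨x, by simp⟩
theorem tab_mem {s : ℕ} (x : Word s) : Cell.tab x ∈ wordCells s := ⟨x, by simp⟩

theorem load_does {s N : ℕ} (smp : Fin N → Sample s) (m : Mem s) :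
    Does (load smp) m (N * (s * 3 + 2 + 1)) (sampleCells s N) fun _ => SamplesLoaded smp := by
  have := Does.forEach (m := m) (l := List.finRange N) (T := s * 3 + 2) (W := sampleCells s N)
    (body := fun i : Fin N => do
      forEach (List.finRange s) fun l => wr (.smpA i l) (bit ((smp i).1 l))
      wr (.smpB i) (bit (smp i).2))
    (fun done m => ∀ i ∈ done, (∀ l, m (.smpA i l) = bit ((smp i).1 l)) ∧
      m (.smpB i) = bit (smp i).2) ?_ (by simp)
  · rw [List.length_finRange] at this
    exact this.imp fun _ m' h i => h i (List.mem_finRange i)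
  intro done i rest _ m hm
  -- The clause `j ≠ i` makes it unnecessary to know that `i` is new: the other samples are
  -- undisturbed, and sample `i` is asserted afresh.
  refine Does.bind (post := fun _ m => (∀ j ∈ done, j ≠ i →
      (∀ l, m (.smpA j l) = bit ((smp j).1 l)) ∧
      m (.smpB j) = bit (smp j).2) ∧ ∀ l, m (.smpA i l) = bit ((smp i).1 l)) ?_ ?_
  · have := Does.forEach (m := m) (l := List.finRange s) (T := 2) (W := sampleCells s N)
      (body := fun l => wr (.smpA i l) (bit ((smp i).1 l)))
      (fun dn m => (∀ j ∈ done, j ≠ i → (∀ l, m (.smpA j l) = bit ((smp j).1 l)) ∧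
      m (.smpB j) = bit (smp j).2) ∧ ∀ l ∈ dn, m (.smpA i l) = bit ((smp i).1 l)) ?_
      ⟨fun j hj _ => hm j hj, by simp⟩
    · rw [List.length_finRange] at this
      exact this.imp fun _ m' h => ⟨h.1, fun l => h.2 l (List.mem_finRange l)⟩
    intro dn l _ _ m hm
    refine Does.wr (smpA_mem i l) ⟨fun j hj hne => ?_, fun l' hl' => ?_⟩
    · have : (j : ℕ) ≠ i := fun h => hne (Fin.ext h)
      simpa [Function.update_apply, this] using hm.1 j hj hne
    · by_cases h : l' = l
      · simp [h]
      · have : l' ∈ dn := by simpa [h] using hl'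
        simpa [Function.update_apply, h] using hm.2 l' this
  · rintro - m ⟨hm, hi⟩
    refine Does.wr (smpB_mem i) fun j hj => ?_
    by_cases h : j = i
    · subst h
      simpa [Function.update_apply] using hi
    · have : (j : ℕ) ≠ i := fun h' => h (Fin.ext h')
      have hj' : j ∈ done := by simpa [h] using hj
      simpa [Function.update_apply, this] using hm j hj' h

theorem readWord_does {s N : ℕ} {smp : Fin N → Sample s} {m : Mem s} (hm : SamplesLoaded smp m)
    (i : Fin N) : Does (readWord i) m (s * 3) (sampleCells s N ∪ wordCells s)
      fun a m' => a = (smp i).1 ∧ m' = m := by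
  have := Does.loop (m := m) (l := List.finRange s) (T := 2) (W := sampleCells s N ∪ wordCells s)
    (body := fun l a => do
      let v ← rd (.smpA i l)
      op (Function.update a l (unbit v))) (b := (0 : Word s))
    (fun done a m' => (∀ l ∈ done, a l = (smp i).1 l) ∧ m' = m) ?_ (by simp)
  · rw [List.length_finRange] at this
    exact this.imp fun a m' h => ⟨funext fun l => h.1 l (List.mem_finRange l), h.2⟩
  rintro done l rest - a m' ⟨ha, rfl⟩
  refine Does.rd_bind (Or.inl (smpA_mem i l)) (Does.op ⟨fun l' hl' => ?_, rfl⟩)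
  by_cases h : l' = l
  · subst h
    simp [(hm i).1, unbit_bit]
  · have : l' ∈ done := by simpa [h] using hl'
    simpa [h] using ha l' this

/-- The case distinction in `llr` is redundant: empty products give p = 1/2, hence log 1 = 0. -/
theorem llr_eq {s N : ℕ} (δ : ℝ) (smp : Fin N → Sample s) (x : Word s) :
    llr δ smp x = Real.log ((1 - pOne δ smp x) / pOne δ smp x) := by
  unfold llr
  split_ifs with h
  · rfl
  · have : (Finset.univ.filter fun i => (smp i).1 = x) = ∅ :=
      Finset.filter_eq_empty_iff.2 fun i _ hi => h ⟨i, hi⟩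
    simp only [pOne, this, Finset.prod_empty]
    norm_num

theorem buildTable_does {s N : ℕ} (δ : ℝ) {smp : Fin N → Sample s} {m : Mem s}
    (hm : SamplesLoaded smp m) :
    Does (buildTable s N δ) m (2 ^ s * 5 + (N * (s * 3 + 9 + 1) + 2 ^ s * 9))
      (sampleCells s N ∪ wordCells s) fun _ m' => ∀ x, m' (.tab x) = llr δ smp x := by
  unfold buildTable
  refine Does.bind (post := fun _ m => SamplesLoaded smp m ∧
    ∀ x, m (.num x) = 1 ∧ m (.den x) = 1) ?_ ?_
  · have := Does.forEach (m := m) (l := words s) (T := 4) (W := sampleCells s N ∪ wordCells s)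
      (body := fun x => do
        wr (.num x) 1
        wr (.den x) 1)
      (fun done m => SamplesLoaded smp m ∧ ∀ x ∈ done, m (.num x) = 1 ∧ m (.den x) = 1) ?_
      ⟨hm, by simp⟩
    · rw [length_words] at this
      exact this.imp fun _ m' h => ⟨h.1, fun x => h.2 x (mem_words x)⟩
    rintro done x rest - m ⟨hm, hd⟩
    refine Does.wr_bind (Or.inr (num_mem x)) (Does.wr (Or.inr (den_mem x)) ⟨?_, fun y hy => ?_⟩)
    · intro i
      simpa [Function.update_apply] using hm i
    · by_cases h : y = x
      · simp [h]
      · have : y ∈ done := by simpa [h] using hy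
        simpa [Function.update_apply, h] using hd y this
  rintro - m ⟨hm, hd⟩
  refine Does.bind (post := fun _ m =>
    ∀ x, m (.num x) = ∏ i with (smp i).1 = x, pFlip δ (smp i).2 ∧
      m (.den x) = ∏ i with (smp i).1 = x, (1 - pFlip δ (smp i).2)) ?_ ?_
  · have := Does.forEach (m := m) (l := List.finRange N) (T := s * 3 + 9)
      (W := sampleCells s N ∪ wordCells s)
      (body := fun i => do
        let a ← readWord i
        let b ← rd (.smpB i)
        let p ← op (pFlip δ (unbit b))
        let v ← rd (.num a)
        wr (.num a) (v * p)
        let q ← op (1 - p)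
        let v' ← rd (.den a)
        wr (.den a) (v' * q))
      -- Each sample contributes its factor to the entry of its own word and the factor 1 to all
      -- others; at the end this becomes the product over a filtered set.
      (fun done m => SamplesLoaded smp m ∧ ∀ x,
        m (.num x) = (done.map fun i => if (smp i).1 = x then pFlip δ (smp i).2 else 1).prod ∧
        m (.den x) = (done.map fun i => if (smp i).1 = x then 1 - pFlip δ (smp i).2 else 1).prod)
        ?_ ⟨hm, by simpa using hd⟩
    · rw [List.length_finRange] at this
      refine this.imp fun _ m' h x => ?_
      rw [(h.2 x).1, (h.2 x).2, Finset.prod_filter, Finset.prod_filter, Fin.prod_univ_def,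
        Fin.prod_univ_def]
      exact ⟨rfl, rfl⟩
    rintro done i rest - m ⟨hm, hd⟩
    refine (readWord_does hm i).bind ?_
    rintro a m' ⟨rfl, rfl⟩
    rw [show 9 = 8 + 1 from rfl]
    refine Does.rd_bind (Or.inl (smpB_mem i)) (Does.op_bind (Does.rd_bind (Or.inr (num_mem _))
      (Does.wr_bind (Or.inr (num_mem _)) (Does.op_bind (Does.rd_bind (Or.inr (den_mem _))
      (Does.wr (Or.inr (den_mem _)) ⟨?_, fun x => ?_⟩))))))
    · intro i
      simpa [Function.update_apply] using hm i
    · rw [(hm i).2, unbit_bit]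
      by_cases h : x = (smp i).1
      · simp [h, (hd (smp i).1).1, (hd (smp i).1).2]
      · simp [h, Ne.symm h, (hd x).1, (hd x).2]
  rintro - m hm
  have := Does.forEach (m := m) (l := words s) (T := 8) (W := sampleCells s N ∪ wordCells s)
      (body := fun x => do
        let v ← rd (.num x)
        let v' ← rd (.den x)
        let d ← op (v + v')
        let p ← op (v / d)
        let q ← op (1 - p)
        let r ← op (q / p)
        wr (.tab x) (Real.log r))
      (fun done m => (∀ x, m (.num x) = ∏ i with (smp i).1 = x, pFlip δ (smp i).2 ∧
        m (.den x) = ∏ i with (smp i).1 = x, (1 - pFlip δ (smp i).2)) ∧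
        ∀ x ∈ done, m (.tab x) = llr δ smp x) ?_
      ⟨hm, by simp⟩
  · rw [length_words] at this
    exact this.imp fun _ m' h x => h.2 x (mem_words x)
  classical
  rintro done x rest - m ⟨hm, hd⟩
  refine Does.rd_bind (Or.inr (num_mem _)) (Does.rd_bind (Or.inr (den_mem _))
    (Does.op_bind (Does.op_bind (Does.op_bind (Does.op_bind
    (Does.wr (Or.inr (tab_mem _)) ⟨?_, fun y hy => ?_⟩))))))
  · intro y
    simpa [Function.update_apply] using hm y
  · by_cases h : y = x
    · subst h
      rw [Function.update_self, (hm y).1, (hm y).2, llr_eq]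
      rfl
    · have : y ∈ done := by simpa [h] using hy
      simpa [Function.update_apply, h] using hd y this

/-- The transform performed by one pass of the fast Fourier transform. -/
def butterfly {s : ℕ} (l : Fin s) (g : Word s → ℝ) (x : Word s) : ℝ :=
  if x l = 0 then g x + g (Function.update x l 1) else g (Function.update x l 0) - g x

theorem zmod_two_ne_zero {b : ZMod 2} (h : b ≠ 0) : b = 1 := by
  revert b; decide

theorem fftPass_does {s : ℕ} (l : Fin s) (g : Word s → ℝ) {m : Mem s} {W : Set (Cell s)}
    (hW : wordCells s ⊆ W) (hm : ∀ x, m (.tab x) = g x) :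
    Does (forEach (words s) fun x =>
      if x l = 0 then do
        let x' ← op (Function.update x l 1)
        let v ← rd (.tab x)
        let v' ← rd (.tab x')
        wr (.tab x) (v + v')
        wr (.tab x') (v - v')
      else op ()) m (2 ^ s * 8) W fun _ m' => ∀ x, m' (.tab x) = butterfly l g x := by
  classical
  have := Does.forEach (m := m) (l := words s) (T := 7) (W := W)
    (body := fun x =>
      if x l = 0 then do
        let x' ← op (Function.update x l 1)
        let v ← rd (.tab x)
        let v' ← rd (.tab x')
        wr (.tab x) (v + v')
        wr (.tab x') (v - v')
      else op ())
    -- The two entries differing in coordinate `l` are replaced together, when the one with bit 0 is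
    -- visited. Hence an entry is final exactly when its representative with bit 0 is in `done`.
    (fun done m => ∀ x, m (.tab x) =
      if Function.update x l 0 ∈ done then butterfly l g x else g x) ?_ (by simpa using hm)
  · rw [length_words] at this
    refine this.imp fun _ m' h x => ?_
    rw [h, if_pos (mem_words _)]
  intro done x rest hl m hm
  -- A second visit would transform the pair again, so the list of words must be free of
  -- repetitions.
  have hx : x ∉ done := by
    have := nodup_words s
    rw [hl] at this
    exact fun h => (List.nodup_append.1 this).2.2 x h x (by simp) rfl
  by_cases h0 : x l = 0
  · rw [if_pos h0]
    have hxx : Function.update x l 0 = x := by rw [← h0]; exact Function.update_eq_self l x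
    have hne : Function.update x l 1 ≠ x := fun h => by
      have := congrFun h l
      rw [Function.update_self, h0] at this
      exact one_ne_zero this
    have h1 : m (.tab x) = g x := by rw [hm, hxx, if_neg hx]
    have h2 : m (.tab (Function.update x l 1)) = g (Function.update x l 1) := by
      rw [hm, Function.update_idem, hxx, if_neg hx]
    refine Does.op_bind (Does.rd_bind (hW (tab_mem _)) (Does.rd_bind (hW (tab_mem _))
      (Does.wr_bind (hW (tab_mem _)) (Does.wr (hW (tab_mem _)) fun y => ?_))))
    rw [h1, h2]
    by_cases hy : y = Function.update x l 1
    · subst hy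
      simp [butterfly, hxx]
    by_cases hy' : y = x
    · subst hy'
      rw [Function.update_of_ne (by simpa using hy), Function.update_self, hxx,
        if_pos (by simp), butterfly, if_pos h0]
    · rw [Function.update_of_ne (by simpa using hy), Function.update_of_ne (by simpa using hy'), hm]
      have : Function.update y l 0 ≠ x := by
        intro h
        by_cases hl0 : y l = 0
        · rw [← hl0, Function.update_eq_self] at h
          exact hy' h
        · apply hy
          rw [← h, Function.update_idem, ← zmod_two_ne_zero hl0, Function.update_eq_self]
      simp [this]
  · rw [if_neg h0]
    refine (Does.op (post := fun _ m' => m' = m) rfl).mono (by norm_num) subset_rfl ?_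
    rintro - m' rfl y
    have : Function.update y l 0 ≠ x := by
      intro h
      apply h0
      rw [← h, Function.update_self]
    rw [hm]
    simp [this]

/-- The Fourier transform with respect to the coordinates in `D` only. -/
def partialFourier {s : ℕ} (D : Finset (Fin s)) (f : Word s → ℝ) (x : Word s) : ℝ :=
  ∑ y, f y * ∏ l, if l ∈ D then (-1 : ℝ) ^ (x l * y l).val else if x l = y l then 1 else 0

theorem partialFourier_empty {s : ℕ} (f : Word s → ℝ) : partialFourier ∅ f = f := by
  funext x
  unfold partialFourier
  rw [Finset.sum_eq_single x]
  · simp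
  · intro y _ hy
    obtain ⟨l, hl⟩ := Function.ne_iff.1 hy
    rw [Finset.prod_eq_zero (Finset.mem_univ l), mul_zero]
    simp [hl.symm]
  · simp

theorem neg_one_pow_val_add (a b : ZMod 2) :
    (-1 : ℝ) ^ (a + b).val = (-1) ^ a.val * (-1) ^ b.val := by
  have ha : a = 0 ∨ a = 1 := by revert a; decide
  have hb : b = 0 ∨ b = 1 := by revert b; decide
  have : (1 + 1 : ZMod 2) = 0 := rfl
  rcases ha with rfl | rfl <;> rcases hb with rfl | rfl <;> simp [ZMod.val_one, this]

theorem neg_one_pow_val_sum {ι : Type*} (S : Finset ι) (a : ι → ZMod 2) :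
    (-1 : ℝ) ^ (∑ i ∈ S, a i).val = ∏ i ∈ S, (-1 : ℝ) ^ (a i).val := by
  classical
  induction S using Finset.induction_on with
  | empty => simp
  | insert i S hi ih => rw [Finset.sum_insert hi, Finset.prod_insert hi, neg_one_pow_val_add, ih]

theorem partialFourier_univ {s : ℕ} (f : Word s → ℝ) :
    partialFourier Finset.univ f = fourier f := by
  funext x
  unfold partialFourier fourier dotProduct
  simp only [Finset.mem_univ, if_true, neg_one_pow_val_sum]

/-- The kernel is a product over the coordinates, and only factor `l` changes, from the indicator of
x_l = y_l to (-1)^(x_l y_l). The latter is the sum (if x_l = 0) or the difference (if x_l = 1) of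
the indicators for the bits 0 and 1. -/
theorem partialFourier_insert {s : ℕ} (D : Finset (Fin s)) {l : Fin s} (hl : l ∉ D)
    (f : Word s → ℝ) :
    partialFourier (insert l D) f = butterfly l (partialFourier D f) := by
  funext x
  have key : ∀ (E : Finset (Fin s)) (z : Word s), partialFourier E f z = ∑ y, f y *
      ((if l ∈ E then (-1 : ℝ) ^ (z l * y l).val else if z l = y l then 1 else 0) *
      ∏ l' ∈ Finset.univ.erase l,
        if l' ∈ E then (-1 : ℝ) ^ (z l' * y l').val else if z l' = y l' then 1 else 0) := by
    intro E z
    unfold partialFourier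
    refine Finset.sum_congr rfl fun y _ => ?_
    exact congrArg (f y * ·) (Finset.mul_prod_erase _ (fun l' =>
      if l' ∈ E then (-1 : ℝ) ^ (z l' * y l').val else if z l' = y l' then 1 else 0)
      (Finset.mem_univ l)).symm
  have rest : ∀ (b : ZMod 2) (y : Word s), (∏ l' ∈ Finset.univ.erase l,
        if l' ∈ D then (-1 : ℝ) ^ (Function.update x l b l' * y l').val
        else if Function.update x l b l' = y l' then 1 else 0) = ∏ l' ∈ Finset.univ.erase l,
        if l' ∈ D then (-1 : ℝ) ^ (x l' * y l').val else if x l' = y l' then 1 else 0 := by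
    intro b y
    refine Finset.prod_congr rfl fun l' hl' => ?_
    rw [Function.update_of_ne (Finset.ne_of_mem_erase hl')]
  have rest' : ∀ y : Word s, (∏ l' ∈ Finset.univ.erase l,
        if l' ∈ insert l D then (-1 : ℝ) ^ (x l' * y l').val
        else if x l' = y l' then 1 else 0) = ∏ l' ∈ Finset.univ.erase l,
        if l' ∈ D then (-1 : ℝ) ^ (x l' * y l').val else if x l' = y l' then 1 else 0 := by
    intro y
    refine Finset.prod_congr rfl fun l' hl' => ?_
    simp only [Finset.mem_insert, Finset.ne_of_mem_erase hl', false_or]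
  unfold butterfly
  simp only [key, rest, rest', if_neg hl, if_pos (Finset.mem_insert_self l D),
    Function.update_self]
  split_ifs with h
  · rw [← Finset.sum_add_distrib]
    refine Finset.sum_congr rfl fun y _ => ?_
    rw [h]
    by_cases hy : y l = 0
    · simp [hy]
    · simp [zmod_two_ne_zero hy]
  · rw [← Finset.sum_sub_distrib]
    refine Finset.sum_congr rfl fun y _ => ?_
    rw [zmod_two_ne_zero h]
    by_cases hy : y l = 0
    · simp [hy]
    · simp [zmod_two_ne_zero hy, ZMod.val_one]

theorem fft_does {s : ℕ} (f : Word s → ℝ) {m : Mem s} {W : Set (Cell s)}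
    (hW : wordCells s ⊆ W) (hm : ∀ x, m (.tab x) = f x) :
    Does (fft s) m (s * (2 ^ s * 8 + 1)) W fun _ m' => ∀ x, m' (.tab x) = fourier f x := by
  have := Does.forEach (m := m) (l := List.finRange s) (T := 2 ^ s * 8) (W := W)
    (body := fun l => forEach (words s) fun x =>
      if x l = 0 then do
        let x' ← op (Function.update x l 1)
        let v ← rd (.tab x)
        let v' ← rd (.tab x')
        wr (.tab x) (v + v')
        wr (.tab x') (v - v')
      else op ())
    (fun done m => ∀ x, m (.tab x) = partialFourier done.toFinset f x) ?_
    (by simpa [partialFourier_empty] using hm)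
  · rw [List.length_finRange] at this
    refine this.imp fun _ m' h x => ?_
    rw [h, List.toFinset_finRange, partialFourier_univ]
  intro done l rest hl m hm
  refine (fftPass_does l _ hW hm).imp fun _ m' h x => ?_
  -- Two passes over the same coordinate would multiply the vector by 2 instead of leaving the
  -- transform unchanged.
  have hld : l ∉ done.toFinset := by
    have := List.nodup_finRange s
    rw [hl] at this
    exact fun h => (List.nodup_append.1 this).2.2 l (List.mem_toFinset.1 h) l (by simp) rfl
  rw [h, ← partialFourier_insert _ hld]
  congr 1
  ext; simp

/-- The result of `argmax` on the vector `g`. -/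
def argmaxVal {s : ℕ} (g : Word s → ℝ) : Word s × ℝ :=
  (words s).foldl (fun best x => if best.2 < g x then (x, g x) else best) (0, g 0)

theorem argmaxVal_spec {s : ℕ} (g : Word s → ℝ) :
    (argmaxVal g).2 = g (argmaxVal g).1 ∧ ∀ x, g x ≤ (argmaxVal g).2 := by
  -- For the induction, the fold starts from any pair consistent with `g`, and its second component
  -- never decreases.
  have H : ∀ (l : List (Word s)) (b : Word s × ℝ), b.2 = g b.1 →
      (l.foldl (fun best x => if best.2 < g x then (x, g x) else best) b).2 =
        g (l.foldl (fun best x => if best.2 < g x then (x, g x) else best) b).1 ∧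
      b.2 ≤ (l.foldl (fun best x => if best.2 < g x then (x, g x) else best) b).2 ∧
      ∀ x ∈ l, g x ≤ (l.foldl (fun best x => if best.2 < g x then (x, g x) else best) b).2 := by
    intro l
    induction l with
    | nil => intro b hb; simp [hb]
    | cons y l ih =>
      intro b hb
      simp only [List.foldl_cons, List.mem_cons, forall_eq_or_imp]
      split_ifs with h
      · have := ih (y, g y) rfl
        exact ⟨this.1, h.le.trans this.2.1, this.2.1, this.2.2⟩
      · have := ih b hb
        exact ⟨this.1, this.2.1, (not_lt.1 h).trans this.2.1, this.2.2⟩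
  have := H (words s) (0, g 0) rfl
  exact ⟨this.1, fun x => this.2.2 x (mem_words x)⟩

theorem argmax_does {s : ℕ} (g : Word s → ℝ) {m : Mem s} {W : Set (Cell s)}
    (hW : wordCells s ⊆ W) (hm : ∀ x, m (.tab x) = g x) :
    Does (argmax s) m (2 ^ s * 3 + 1) W fun r _ => r = argmaxVal g := by
  refine Does.rd_bind (hW (tab_mem 0)) ?_
  have := Does.loop (m := m) (l := words s) (T := 2) (W := W)
    (body := fun x best => do
      let v ← rd (.tab x)
      op (if best.2 < v then (x, v) else best)) (b := ((0 : Word s), g 0))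
    (fun done b m' => b = done.foldl (fun best x => if best.2 < g x then (x, g x) else best)
      (0, g 0) ∧ ∀ x, m' (.tab x) = g x) ?_ ⟨rfl, hm⟩
  · rw [length_words] at this
    rw [hm]
    exact this.imp fun _ _ h => h.1
  rintro done x rest - b m ⟨hb, hm⟩
  refine Does.rd_bind (hW (tab_mem x)) (Does.op ⟨?_, hm⟩)
  rw [List.foldl_append, ← hb, hm]
  rfl

/-- The result of `solve` on the given samples. -/
def solveVal {s N : ℕ} (δ : ℝ) (smp : Fin N → Sample s) : Option (Word s) :=
  if threshold δ N ≤ (argmaxVal (fourier (llr δ smp))).2 then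
    some (argmaxVal (fourier (llr δ smp))).1 else none

theorem iterSpec_solveVal {s N : ℕ} (δ : ℝ) (smp : Fin N → Sample s) :
    IterSpec δ smp (solveVal δ smp) := by
  obtain ⟨h1, h2⟩ := argmaxVal_spec (fourier (llr δ smp))
  unfold solveVal
  split_ifs with h
  · exact Or.inr ⟨_, rfl, fun x => h1 ▸ h2 x, h1 ▸ h⟩
  · exact Or.inl ⟨rfl, fun x => (h2 x).trans_lt (not_le.1 h)⟩

/-- A bound for the number of steps of `solve`. -/
def solveTime (s N : ℕ) : ℕ :=
  2 ^ s * 5 + (N * (s * 3 + 9 + 1) + 2 ^ s * 9) +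
    (s * (2 ^ s * 8 + 1) + (2 ^ s * 3 + 1 + 1))

theorem solve_does {s N : ℕ} (δ : ℝ) {smp : Fin N → Sample s} {m : Mem s}
    (hm : SamplesLoaded smp m) :
    Does (solve s N δ) m (solveTime s N) (sampleCells s N ∪ wordCells s)
      fun r _ => r = solveVal δ smp := by
  refine (buildTable_does δ hm).bind fun _ m hm => (fft_does _ Set.subset_union_right hm).bind
    fun _ m hm => (argmax_does _ Set.subset_union_right hm).bind fun best m hb => Does.op ?_
  rw [hb]
  rfl

theorem iterSpec_load_solve {s N : ℕ} (δ : ℝ) (smp : Fin N → Sample s) (m : Mem s) :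
    IterSpec δ smp ((load smp >>= fun _ => solve s N δ).run m).1 := by
  have h := ((load_does smp m).mono le_rfl Set.subset_union_left fun _ _ h => h).bind
    fun _ m hm => solve_does δ hm
  rw [h.post]
  exact iterSpec_solveVal δ smp

/-! ### The samples computed by an iteration -/

theorem sum_position {n s : ℕ} (P : Pos n s) (g : Fin n → ZMod 2) :
    ∑ l, g (position P l) = ∑ j ∈ P.1, g j := by
  conv_rhs => rw [← Finset.map_orderEmbOfFin_univ P.1 P.2]
  rw [Finset.sum_map]
  rfl

/-- The codeword `c` disappears because it is orthogonal to `h`; what is left is ⟨e,h⟩, split over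
the positions in `P` and outside. -/
theorem sum_mul_received {n m s : ℕ} (P : Pos n s) {H : Matrix (Fin m) (Fin n) (ZMod 2)}
    {c : Fin n → ZMod 2} (hc : c ∈ code H) (e : Fin n → ZMod 2) {h : Fin n → ZMod 2}
    (hh : h ∈ dual (code H)) :
    ∑ j, h j * (c + e) j = dotProduct (onP P e) (onP P h) + dotN P e h := by
  have h0 : ∑ j, c j * h j = 0 := hh c hc
  have h1 : dotProduct (onP P e) (onP P h) = ∑ j ∈ P.1, e j * h j :=
    sum_position P fun j => e j * h j
  rw [h1, dotN, Finset.sum_add_sum_compl, ← zero_add (∑ j, e j * h j), ← h0,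
    ← Finset.sum_add_distrib]
  refine Finset.sum_congr rfl fun j _ => ?_
  rw [Pi.add_apply]
  ring

/-- The cells of the set of positions and of the received word. -/
def inputCells (n s : ℕ) : Set (Cell s) :=
  {c | (∃ l < s, c = .pos l) ∨ ∃ j < n, c = .inp j}

theorem pos_mem {n s : ℕ} (l : Fin s) : (Cell.pos l : Cell s) ∈ inputCells n s :=
  Or.inl ⟨l, l.2, rfl⟩

theorem inp_mem {n s : ℕ} (j : Fin n) : (Cell.inp j : Cell s) ∈ inputCells n s :=
  Or.inr ⟨j, j.2, rfl⟩

/-- A bound for the number of steps of `source`, without the call of `create`. -/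
def sourceTime (n s N : ℕ) : ℕ := n * 2 + s * 3 + N * (s * 5 + (n * 4 + 2) + 1)

theorem samples_does {n m s N : ℕ} {y : Fin n → ZMod 2} {H : Matrix (Fin m) (Fin n) (ZMod 2)}
    {P : Pos n s} {h : Fin N → Fin n → ZMod 2} {V : Set (Cell s)} {M : Mem s}
    (hin : InputLoaded y H M) (hpos : PosLoaded P M) (hchk : ChecksLoaded h M)
    (hV : inputCells n s ∪ sampleCells s N ⊆ V)
    (hVc : ∀ (i : Fin N) (j : Fin n), Cell.chk (i : ℕ) (j : ℕ) ∈ V) :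
    Does (forEach (List.finRange N) fun i => do
      forEach (List.finRange s) fun l => do
        let v ← rd (.pos l)
        let h ← rd (.chk i ⌊v⌋₊)
        wr (.smpA i l) h
      let b ← loop (List.finRange n) (fun j b => do
        let h ← rd (.chk i (j : ℕ))
        let v ← rd (.inp (j : ℕ))
        op (b + unbit h * unbit v)) (0 : ZMod 2)
      wr (.smpB i) (bit b)) M (N * (s * 5 + (n * 4 + 2) + 1)) V fun _ M' =>
        SamplesLoaded (fun i => (onP P (h i), ∑ j, h i j * y j)) M' ∧ InputLoaded y H M' := by
  have := Does.forEach (m := M) (l := List.finRange N) (T := s * 5 + (n * 4 + 2)) (W := V)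
    (body := fun i => do
      forEach (List.finRange s) fun l => do
        let v ← rd (.pos l)
        let h ← rd (.chk i ⌊v⌋₊)
        wr (.smpA i l) h
      let b ← loop (List.finRange n) (fun j b => do
        let h ← rd (.chk i (j : ℕ))
        let v ← rd (.inp (j : ℕ))
        op (b + unbit h * unbit v)) (0 : ZMod 2)
      wr (.smpB i) (bit b))
    (fun done M => (InputLoaded y H M ∧ PosLoaded P M ∧ ChecksLoaded h M) ∧ ∀ i ∈ done,
      (∀ l, M (.smpA i l) = bit (onP P (h i) l)) ∧ M (.smpB i) = bit (∑ j, h i j * y j)) ?_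
      ⟨⟨hin, hpos, hchk⟩, by simp⟩
  · rw [List.length_finRange] at this
    exact this.imp fun _ M' h => ⟨fun i => h.2 i (List.mem_finRange i), h.1.1⟩
  clear hin hpos hchk M
  rintro done i rest - M hM
  refine Does.bind (post := fun _ M => (InputLoaded y H M ∧ PosLoaded P M ∧ ChecksLoaded h M) ∧
    (∀ i' ∈ done, i' ≠ i → (∀ l, M (.smpA i' l) = bit (onP P (h i') l)) ∧
      M (.smpB i') = bit (∑ j, h i' j * y j)) ∧ ∀ l, M (.smpA i l) = bit (onP P (h i) l)) ?_ ?_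
  · have := Does.forEach (m := M) (l := List.finRange s) (T := 4) (W := V)
      (body := fun l => do
        let v ← rd (.pos l)
        let h ← rd (.chk i ⌊v⌋₊)
        wr (.smpA i l) h)
      (fun dn M => (InputLoaded y H M ∧ PosLoaded P M ∧ ChecksLoaded h M) ∧
        (∀ i' ∈ done, i' ≠ i → (∀ l, M (.smpA i' l) = bit (onP P (h i') l)) ∧
          M (.smpB i') = bit (∑ j, h i' j * y j)) ∧
          ∀ l ∈ dn, M (.smpA i l) = bit (onP P (h i) l)) ?_
      ⟨hM.1, fun i' hi' _ => hM.2 i' hi', by simp⟩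
    · rw [List.length_finRange] at this
      exact this.imp fun _ m' h => ⟨h.1, h.2.1, fun l => h.2.2 l (List.mem_finRange l)⟩
    classical
    rintro dn l _ - M ⟨⟨hin, hpos, hchk⟩, hdone, hdn⟩
    refine Does.rd_bind (hV (Or.inl (pos_mem l))) ?_
    -- Addresses are stored as real numbers; the floor recovers the natural number.
    rw [hpos l, Nat.floor_natCast]
    refine Does.rd_bind (hVc _ _) (Does.wr (hV (Or.inr (smpA_mem i l)))
      ⟨⟨⟨fun j => ?_, fun a j => ?_⟩, fun l => ?_, fun i j => ?_⟩, fun i' hi' hne => ?_,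
        fun l' hl' => ?_⟩)
    · simpa [Function.update_apply] using hin.1 j
    · simpa [Function.update_apply] using hin.2 a j
    · simpa [Function.update_apply] using hpos l
    · simpa [Function.update_apply] using hchk i j
    · have : (i' : ℕ) ≠ i := fun h => hne (Fin.ext h)
      simpa [Function.update_apply, this] using hdone i' hi' hne
    · by_cases hl : l' = l
      · subst hl
        rw [Function.update_self, hchk]
        rfl
      · have : l' ∈ dn := by simpa [hl] using hl'
        simpa [Function.update_apply, hl] using hdn l' this
  rintro - M ⟨⟨hin, hpos, hchk⟩, hdone, hi⟩
  refine Does.bind (post := fun b M' => b = ∑ j, h i j * y j ∧ M' = M) ?_ ?_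
  · have := Does.loop (m := M) (l := List.finRange n) (T := 3) (W := V)
      (body := fun j b => do
        let h ← rd (.chk i (j : ℕ))
        let v ← rd (.inp (j : ℕ))
        op (b + unbit h * unbit v)) (b := (0 : ZMod 2))
      (fun dn b M' => b = (dn.map fun j => h i j * y j).sum ∧ M' = M) ?_ (by simp)
    · rw [List.length_finRange] at this
      refine this.imp fun b M' hb => ⟨?_, hb.2⟩
      rw [hb.1, Fin.sum_univ_def]
    rintro dn j _ - b M' ⟨rfl, rfl⟩
    refine Does.rd_bind (hVc _ _) (Does.rd_bind (hV (Or.inl (inp_mem j))) (Does.op ⟨?_, rfl⟩))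
    rw [hchk i j, hin.1 j, unbit_bit, unbit_bit]
    simp
  rintro - M' ⟨rfl, rfl⟩
  refine Does.wr (hV (Or.inr (smpB_mem i)))
      ⟨⟨⟨fun j => ?_, fun a j => ?_⟩, fun l => ?_, fun i j => ?_⟩, fun i' hi' => ?_⟩
  · simpa [Function.update_apply] using hin.1 j
  · simpa [Function.update_apply] using hin.2 a j
  · simpa [Function.update_apply] using hpos l
  · simpa [Function.update_apply] using hchk i j
  · by_cases hii : i' = i
    · subst hii
      simpa [Function.update_apply] using hi
    · have h1 : (i' : ℕ) ≠ i := fun h' => hii (Fin.ext h')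
      have h2 : i' ∈ done := by simpa [hii] using hi'
      simpa [Function.update_apply, h1] using hdone i' h2 hii

theorem writePos_does {n s : ℕ} (P : Pos n s) (M : Mem s) :
    Does (forEach (List.finRange s) fun l => wr (.pos l) ((position P l : ℕ) : ℝ)) M (s * 3)
      {c | ∃ l < s, c = .pos l} fun _ M' => PosLoaded P M' := by
  have := Does.forEach (m := M) (l := List.finRange s) (T := 2) (W := {c | ∃ l < s, c = .pos l})
    (body := fun l => wr (.pos l) ((position P l : ℕ) : ℝ))
    (fun dn M' => ∀ l ∈ dn, M' (.pos l) = ((position P l : ℕ) : ℝ)) ?_ (by simp)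
  · rw [List.length_finRange] at this
    exact this.imp fun _ M' h l => h l (List.mem_finRange l)
  rintro dn l _ - M hM
  refine Does.wr ⟨l, l.2, rfl⟩ fun l' hl' => ?_
  by_cases h : l' = l
  · simp [h]
  · have h1 : (l' : ℕ) ≠ l := fun h' => h (Fin.ext h')
    have : l' ∈ dn := by simpa [h] using hl'
    simpa [Function.update_apply, h1] using hM l' this

theorem source_does {n m s N w Teq : ℕ} {y : Fin n → ZMod 2} {H : Matrix (Fin m) (Fin n) (ZMod 2)}
    {P : Pos n s} {W : Finset (Cell s)} {create : Prog s Unit} {M : Mem s}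
    (hin : InputLoaded y H M) (hcr : IsCreate y H N w Teq W P create) :
    ∃ h : Fin N → Fin n → ZMod 2, AreChecks (code H) w P h ∧
      Does (source N P create) M (sourceTime n s N + Teq) (W ∪ (inputCells n s ∪ sampleCells s N))
        fun _ M' => SamplesLoaded (fun i => (onP P (h i), ∑ j, h i j * y j)) M' ∧
          InputLoaded y H M' := by
  set V : Set (Cell s) := W ∪ (inputCells n s ∪ sampleCells s N) with hVdef
  have d1 : Does (forEach (List.finRange n) fun _ => (op () : Prog s Unit)) M (n * 2) V
      fun _ M' => M' = M := by
    have := Does.forEach (m := M) (l := List.finRange n) (T := 1) (W := V)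
      (body := fun _ => (op () : Prog s Unit)) (fun _ M' => M' = M)
      (fun _ _ _ _ _ h => Does.op h) rfl
    rwa [List.length_finRange] at this
  -- The checks provided by `hcr` depend on the memory in which `create` starts, so that memory is
  -- named exactly before they are extracted.
  set M₁ := ((forEach (List.finRange s) fun l =>
    wr (.pos l) ((position P l : ℕ) : ℝ)).run M).2 with hM₁
  have d2 : Does (forEach (List.finRange s) fun l => wr (.pos l) ((position P l : ℕ) : ℝ))
      M (s * 3) V fun _ M' => M' = M₁ :=
    ⟨rfl, (writePos_does P M).time, fun c hc =>
      Or.inr (Or.inl (Or.inl ((writePos_does P M).cells c hc)))⟩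
  have hM₁' := (writePos_does P M).frame.post
  rw [← hM₁] at hM₁'
  obtain ⟨hpos, hfr⟩ := hM₁'
  have hin₁ : InputLoaded y H M₁ :=
    ⟨fun j => by rw [hfr _ (by simp)]; exact hin.1 j,
      fun i j => by rw [hfr _ (by simp)]; exact hin.2 i j⟩
  obtain ⟨ht, hcl, hchk, hin₂, hpos₂, h, hh, hld⟩ := hcr M₁ hin₁ hpos
  have d3 : Does create M₁ Teq V fun _ M' => M' = (create.run M₁).2 :=
    ⟨rfl, ht, fun c hc => Or.inl (hcl hc)⟩
  refine ⟨h, hh, ?_⟩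
  have d4 := samples_does (V := V) hin₂ hpos₂ hld Set.subset_union_right
    fun i j => Or.inl (hcl (hchk i j))
  have : Does (source N P create) M _ V _ :=
    d1.bind fun _ M' h => by
      subst h
      exact d2.bind fun _ M' h => by
        subst h
        exact d3.bind fun _ M' h => by
          subst h
          exact d4
  exact this.mono (by unfold sourceTime; omega) subset_rfl fun _ _ h => h

/-! ### The outer loop -/

/-- The output of the decoder when the iterations work on the given samples. -/
def decoderVal {n s N : ℕ} (δ : ℝ) :
    List (Pos n s × (Fin N → Sample s)) → Option (Pos n s × Word s)
  | [] => none
  | (P, smp) :: rest =>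
    match solveVal δ smp with
    | some x => some (P, x)
    | none => decoderVal δ rest

/-- The remaining iterations are needed only from the actual memory left by `solve`. Their cost is
charged even if the iteration is accepted. -/
theorem decoder_cons_does {n s N T T' : ℕ} {δ : ℝ} {P : Pos n s} {src : Prog s Unit}
    {rest : List (Pos n s × Prog s Unit)} {smp : Fin N → Sample s}
    {rest' : List (Pos n s × (Fin N → Sample s))} {M : Mem s} {V : Set (Cell s)}
    (hV : sampleCells s N ∪ wordCells s ⊆ V)
    (hsrc : Does src M T V fun _ M' => SamplesLoaded smp M')
    (hrest : Does (decoder N δ rest) ((solve s N δ).run (src.run M).2).2 T' V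
      fun r _ => r = decoderVal δ rest') :
    Does (decoder N δ ((P, src) :: rest)) M (T + (solveTime s N + (T' + 1))) V
      fun r _ => r = decoderVal δ ((P, smp) :: rest') := by
  have d1 : Does src M T V fun _ M' => M' = (src.run M).2 := ⟨rfl, hsrc.time, hsrc.cells⟩
  have hs := solve_does δ hsrc.post
  have d2 : Does (solve s N δ) (src.run M).2 (solveTime s N) V fun r M' =>
      r = solveVal δ smp ∧ M' = ((solve s N δ).run (src.run M).2).2 :=
    ⟨⟨hs.post, rfl⟩, hs.time, fun c hc => hV (hs.cells c hc)⟩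
  refine d1.bind fun _ M' h => ?_
  subst h
  refine d2.bind fun r M' h => ?_
  obtain ⟨rfl, rfl⟩ := h
  unfold decoderVal
  cases solveVal δ smp with
  | some x =>
    refine Does.mono (T := 1) (T' := T' + 1) (post := fun r _ => r = some (P, x)) (Does.op rfl)
      (Nat.le_add_left 1 T') subset_rfl fun _ _ h => h
  | none => exact hrest.tick

/-- The initial memory has no influence on the output, which reduces the probabilistic analysis to
the pure function `decoderVal`. -/
theorem run_rlpnOn {n s N Niter : ℕ} (δ : ℝ) (it : Fin Niter → Pos n s × (Fin N → Sample s))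
    (M : Mem s) : ((rlpnOn δ it).run M).1 = decoderVal δ (List.ofFn it) := by
  have H : ∀ (l : List (Pos n s × (Fin N → Sample s))) (M : Mem s), ∃ T,
      Does (decoder N δ (l.map fun q => (q.1, load q.2))) M T Set.univ
        fun r _ => r = decoderVal δ l := by
    intro l
    induction l with
    | nil => exact fun M => ⟨0, rfl, le_rfl, fun c _ => Set.mem_univ c⟩
    | cons q l ih =>
      intro M
      obtain ⟨T, hT⟩ := ih ((solve s N δ).run ((load q.2).run M).2).2
      exact ⟨_, decoder_cons_does (Set.subset_univ _)
        ((load_does q.2 M).mono le_rfl (Set.subset_univ _) fun _ _ h => h) hT⟩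
  obtain ⟨T, hT⟩ := H (List.ofFn it) M
  rw [List.map_ofFn] at hT
  exact hT.post

/-- Induction over the iterations: `solve` touches only sample and word cells, so by the frame rule
the input is still loaded when the next iteration starts. -/
theorem rlpn_does {n m s N w Teq : ℕ} (δ : ℝ) (e : Fin n → ZMod 2)
    {H : Matrix (Fin m) (Fin n) (ZMod 2)} {c : Fin n → ZMod 2} (hc : c ∈ code H)
    {W : Finset (Cell s)} :
    ∀ {Niter : ℕ} (P : Fin Niter → Pos n s) (create : Fin Niter → Prog s Unit) (M : Mem s),
    (∀ j, IsCreate (c + e) H N w Teq W (P j) (create j)) → InputLoaded (c + e) H M →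
    ∃ h : Fin Niter → Fin N → Fin n → ZMod 2, (∀ j, AreChecks (code H) w (P j) (h j)) ∧
      Does (rlpn N δ P create) M (Niter * (sourceTime n s N + Teq + (solveTime s N + 1)))
        (W ∪ (inputCells n s ∪ sampleCells s N) ∪ wordCells s) fun r _ =>
          r = decoderVal δ (List.ofFn fun j => (P j, lpnSamples (onP (P j) e)
            (fun i => onP (P j) (h j i)) fun i => dotN (P j) e (h j i))) := by
  intro Niter
  induction Niter with
  | zero =>
    intro P create M _ _
    exact ⟨fun j => j.elim0, fun j => j.elim0, by simp [rlpn, decoder, decoderVal, Prog.run],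
      by simp [rlpn, decoder, Prog.time], by simp [rlpn, decoder, Prog.cells]⟩
  | succ Niter ih =>
    intro P create M hcr hin
    obtain ⟨h₀, hh₀, hd⟩ := source_does hin (hcr 0)
    obtain ⟨hsm, hin'⟩ := hd.post
    have hin'' : InputLoaded (c + e) H
        ((solve s N δ).run ((source N (P 0) (create 0)).run M).2).2 := by
      have hfr := (solve_does δ hsm).frame.post.2
      refine ⟨fun j => ?_, fun i j => ?_⟩
      · rw [hfr _ (by simp [sampleCells, wordCells])]; exact hin'.1 j
      · rw [hfr _ (by simp [sampleCells, wordCells])]; exact hin'.2 i j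
    obtain ⟨h, hh, hd'⟩ := ih (fun j => P j.succ) (fun j => create j.succ) _
      (fun j => hcr j.succ) hin''
    refine ⟨Fin.cons h₀ h, Fin.cases hh₀ hh, ?_⟩
    have heq : (fun i => (onP (P 0) (h₀ i), ∑ j, h₀ i j * (c + e) j)) =
        lpnSamples (onP (P 0) e) (fun i => onP (P 0) (h₀ i)) fun i => dotN (P 0) e (h₀ i) := by
      funext i
      have : h₀ i ∈ dual (code H) := by
        have := hh₀.2 i
        simp only [checks, Finset.mem_filter] at this
        exact this.2.1
      rw [sum_mul_received (P 0) hc e this]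
      rfl
    rw [heq] at hd
    have := decoder_cons_does (N := N) (δ := δ) (P := P 0)
      (V := W ∪ (inputCells n s ∪ sampleCells s N) ∪ wordCells s)
      (Set.union_subset_union_left _ (Set.subset_union_right.trans Set.subset_union_right))
      (hd.mono le_rfl Set.subset_union_left fun _ _ h => h.1) hd'
    unfold rlpn
    rw [List.ofFn_succ, List.ofFn_succ]
    refine this.mono ?_ subset_rfl fun _ _ h => h
    rw [Nat.succ_mul]
    omega

/-! ### Space and time -/

/-- The N·n output cells are distinct and all accessed by `create`, one cell per step at most. This
absorbs every term in `N` and `n` of the cost. -/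
theorem card_checks_le {n m s N w Teq : ℕ} {y : Fin n → ZMod 2}
    {H : Matrix (Fin m) (Fin n) (ZMod 2)} {P : Pos n s} {W : Finset (Cell s)}
    {create : Prog s Unit} {M : Mem s} (hin : InputLoaded y H M)
    (hcr : IsCreate y H N w Teq W P create) : N * n ≤ Teq ∧ N * n ≤ W.card := by
  classical
  -- `M` need not hold the set `P`, as `hcr` requires; writing `P` into it yields a memory that
  -- does.
  obtain ⟨hpos, hfr⟩ := (writePos_does P M).frame.post
  obtain ⟨ht, hcl, hchk, -⟩ := hcr _
    ⟨fun j => by rw [hfr _ (by simp)]; exact hin.1 j,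
      fun i j => by rw [hfr _ (by simp)]; exact hin.2 i j⟩ hpos
  have hinj : Function.Injective fun q : Fin N × Fin n => (Cell.chk q.1 q.2 : Cell s) := by
    rintro ⟨i, j⟩ ⟨i', j'⟩ h
    simp only [Cell.chk.injEq] at h
    exact Prod.ext (Fin.ext h.1) (Fin.ext h.2)
  have hle := Finset.card_le_card (s := Finset.univ.image fun q : Fin N × Fin n =>
    (Cell.chk q.1 q.2 : Cell s)) (Finset.image_subset_iff.2 fun q _ => hchk q.1 q.2)
  rw [Finset.card_image_of_injective _ hinj, Finset.card_univ, Fintype.card_prod, Fintype.card_fin,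
    Fintype.card_fin] at hle
  exact ⟨hle.trans ((card_cells_le_time _ _).trans ht), hle.trans (Finset.card_le_card hcl)⟩

theorem card_cells_le {n s N : ℕ} (W F : Finset (Cell s))
    (hF : ∀ c ∈ F, c ∈ (W : Set (Cell s)) ∪ (inputCells n s ∪ sampleCells s N) ∪ wordCells s) :
    F.card ≤ W.card + (s + n + (N * s + N)) + 3 * 2 ^ s := by
  classical
  have hsub : F ⊆ W ∪ (((Finset.range s).image fun l => Cell.pos l) ∪
      ((Finset.range n).image fun j => Cell.inp j) ∪
      (((Finset.range N ×ˢ (Finset.univ : Finset (Fin s))).image fun q => Cell.smpA q.1 q.2) ∪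
      ((Finset.range N).image fun i => Cell.smpB i))) ∪
      (((Finset.univ : Finset (Word s)).image fun x => Cell.num x) ∪
      (((Finset.univ : Finset (Word s)).image fun x => Cell.den x) ∪
      ((Finset.univ : Finset (Word s)).image fun x => Cell.tab x))) := by
    intro c hc
    have := hF c hc
    simp only [Finset.mem_union, Finset.mem_image, Finset.mem_range, Finset.mem_product,
      Finset.mem_univ, true_and, and_true, Prod.exists]
    rcases this with (h | ((⟨l, hl, rfl⟩ | ⟨j, hj, rfl⟩) | (⟨i, hi, l, rfl⟩ | ⟨i, hi, rfl⟩))) |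
      ⟨x, rfl | rfl | rfl⟩
    · exact Or.inl (Or.inl h)
    · exact Or.inl (Or.inr (Or.inl (Or.inl ⟨l, hl, rfl⟩)))
    · exact Or.inl (Or.inr (Or.inl (Or.inr ⟨j, hj, rfl⟩)))
    · exact Or.inl (Or.inr (Or.inr (Or.inl ⟨i, l, hi, rfl⟩)))
    · exact Or.inl (Or.inr (Or.inr (Or.inr ⟨i, hi, rfl⟩)))
    · exact Or.inr (Or.inl ⟨x, rfl⟩)
    · exact Or.inr (Or.inr (Or.inl ⟨x, rfl⟩))
    · exact Or.inr (Or.inr (Or.inr ⟨x, rfl⟩))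
  have hw : (Finset.univ : Finset (Word s)).card = 2 ^ s := by simp [ZMod.card]
  have hwi : ∀ f : Word s → Cell s, ((Finset.univ : Finset (Word s)).image f).card ≤ 2 ^ s :=
    fun f => hw ▸ Finset.card_image_le
  have hr : ∀ (a : ℕ) (f : ℕ → Cell s), ((Finset.range a).image f).card ≤ a :=
    fun a f => Finset.card_image_le.trans (Finset.card_range a).le
  have hp : ((Finset.range N ×ˢ (Finset.univ : Finset (Fin s))).image
      fun q => Cell.smpA q.1 q.2).card ≤ N * s :=
    Finset.card_image_le.trans (by simp)
  refine (Finset.card_le_card hsub).trans ((Finset.card_union_le _ _).trans (add_le_add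
    ((Finset.card_union_le _ _).trans (add_le_add le_rfl ((Finset.card_union_le _ _).trans
      (add_le_add ((Finset.card_union_le _ _).trans (add_le_add (hr _ _) (hr _ _)))
        ((Finset.card_union_le _ _).trans (add_le_add hp (hr _ _)))))))
    ((Finset.card_union_le _ _).trans ((add_le_add (hwi _) ((Finset.card_union_le _ _).trans
      (add_le_add (hwi _) (hwi _)))).trans (by omega)))))

theorem space_time_le {n s k N w Niter Seq Teq : ℕ} (hs : s ≤ n) (hn : 1 ≤ n) (hN : 1 ≤ N)
    {δ : ℝ} {e : Fin n → ZMod 2} {H : Matrix (Fin (n - k)) (Fin n) (ZMod 2)} {c : Fin n → ZMod 2}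
    {P : Fin Niter → Pos n s} {create : Fin Niter → Prog s Unit} {W : Finset (Cell s)} {M : Mem s}
    (hex : IsExecution k N w Seq Teq e H c P create W M) :
    ((rlpn N δ P create).cells M).card ≤ 5 * (Seq + 2 ^ s) ∧
      (rlpn N δ P create).time M ≤ 40 * (Niter * (Teq + (s + 1) * 2 ^ s)) := by
  obtain ⟨hc, hW, hcr, hin⟩ := hex
  obtain ⟨h, -, hd⟩ := rlpn_does δ e hc P create M hcr hin
  -- Without iterations there is no call of `create` to compare with, but then no step is made at
  -- all.
  rcases Nat.eq_zero_or_pos Niter with rfl | hpos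
  · have := hd.time
    rw [zero_mul] at this
    have h2 := card_cells_le_time (rlpn N δ P create) M
    omega
  obtain ⟨hT, hWN⟩ := card_checks_le hin (hcr ⟨0, hpos⟩)
  have hnN : n ≤ N * n := Nat.le_mul_of_pos_left n hN
  have hNN : N ≤ N * n := Nat.le_mul_of_pos_right N hn
  have hsN : N * s ≤ N * n := Nat.mul_le_mul_left N hs
  have h2 : 1 ≤ 2 ^ s := Nat.one_le_two_pow
  have hs2 : s ≤ s * 2 ^ s := Nat.le_mul_of_pos_right s h2
  constructor
  · have := card_cells_le W _ hd.cells
    omega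
  · refine hd.time.trans ?_
    rw [← mul_assoc, mul_comm 40 Niter, mul_assoc]
    refine Nat.mul_le_mul_left _ ?_
    unfold sourceTime solveTime
    nlinarith

/-- Since log 2 ≥ 1/2 and log 3 ≥ 1. It turns the factor s + 1 of the fast Fourier transform into
one more logarithm. -/
theorem one_add_le_three_log {s : ℕ} {g : ℝ} (h3 : 3 ≤ g) (hg : (2 : ℝ) ^ s ≤ g) :
    1 ≤ Real.log g ∧ (s : ℝ) + 1 ≤ 3 * Real.log g := by
  have h0 : (0 : ℝ) < g := by linarith
  have h1 : 1 ≤ Real.log g := by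
    rw [Real.le_log_iff_exp_le h0]
    exact (Real.exp_one_lt_d9.le.trans (by norm_num)).trans h3
  have h2 : s * Real.log 2 ≤ Real.log g := by
    rw [← Real.log_pow]
    exact Real.log_le_log (by positivity) hg
  have h4 := Real.log_two_gt_d9
  have : (s : ℝ) * (1 / 2) ≤ s * Real.log 2 :=
    mul_le_mul_of_nonneg_left (by linarith) (Nat.cast_nonneg s)
  exact ⟨h1, by linarith⟩

theorem time_isSoftO {k s w N Niter Seq Teq : ℕ → ℕ} {p : ℕ → ℝ} (hs : ∀ n, s n ≤ n)
    (e : ∀ n, Fin n → ZMod 2) (hp1 : ∀ n, p n ≤ 1)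
    (hN : ∀ᶠ n in Filter.atTop, 1 ≤ N n) (hp : ∀ᶠ n in Filter.atTop, 0 < p n) {a : ℕ}
    (hO : (fun n => (Niter n : ℝ)) =O[Filter.atTop] fun n =>
      1 / p n * Real.log ((Teq n + 2 ^ s n) / p n) ^ a) :
    ∃ (K : ℝ) (a : ℕ), ∀ᶠ n in Filter.atTop,
      ∀ (δ : ℝ) (H : Matrix (Fin (n - k n)) (Fin n) (ZMod 2))
      (c : Fin n → ZMod 2) (P : Fin (Niter n) → Pos n (s n))
      (create : Fin (Niter n) → Prog (s n) Unit) (W : Finset (Cell (s n))) (M : Mem (s n)),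
      IsExecution (k n) (N n) (w n) (Seq n) (Teq n) (e n) H c P create W M →
      ((rlpn (N n) δ P create).time M : ℝ) ≤
        K * ((Teq n + 2 ^ s n) / p n * Real.log ((Teq n + 2 ^ s n) / p n) ^ a) := by
  obtain ⟨C, hC0, hC⟩ := hO.exists_nonneg
  -- 120 is the 40 of `space_time_le` times the 3 of `one_add_le_three_log`. Taking n ≥ 3 below
  -- forces `Teq` ≥ 3 when there is an iteration, so that the logarithm is at least 1.
  refine ⟨120 * C, a + 1, ?_⟩
  filter_upwards [hN, hp, hC.bound, Filter.eventually_ge_atTop 3] with n hN hp hC hn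
  intro δ H c P create W M hex
  have hT := (space_time_le (δ := δ) (hs n) (by omega) hN hex).2
  have h2 : (1 : ℝ) ≤ 2 ^ s n := one_le_pow₀ (by norm_num)
  set G : ℝ := Teq n + 2 ^ s n with hG
  have hTeq : (0 : ℝ) ≤ Teq n := Nat.cast_nonneg _
  have hg : G ≤ G / p n := by
    rw [le_div_iff₀ hp]
    exact mul_le_of_le_one_right (by linarith) (hp1 n)
  have hlog0 : 0 ≤ Real.log (G / p n) := Real.log_nonneg (by linarith)
  have hR : 0 ≤ 120 * C * (G / p n * Real.log (G / p n) ^ (a + 1)) := by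
    have : 0 ≤ G / p n := by linarith
    positivity
  rcases Nat.eq_zero_or_pos (Niter n) with h0 | hpos
  · have : (rlpn (N n) δ P create).time M = 0 := Nat.le_zero.1 (hT.trans (by simp [h0]))
    rw [this]
    exact_mod_cast hR
  have hTn : (3 : ℝ) ≤ Teq n := by
    have h1 := (card_checks_le hex.2.2.2 (hex.2.2.1 ⟨0, hpos⟩)).1
    have h2 : n ≤ N n * n := Nat.le_mul_of_pos_left n hN
    exact_mod_cast hn.trans (h2.trans h1)
  obtain ⟨hl1, hl2⟩ := one_add_le_three_log (s := s n) (g := G / p n) (by linarith) (by linarith)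
  rw [Real.norm_of_nonneg (Nat.cast_nonneg _), Real.norm_of_nonneg (by positivity)] at hC
  have hT' : ((rlpn (N n) δ P create).time M : ℝ) ≤
      40 * (Niter n * (Teq n + (s n + 1) * 2 ^ s n)) := by exact_mod_cast hT
  set L := Real.log (G / p n) with hL
  calc ((rlpn (N n) δ P create).time M : ℝ)
      ≤ 40 * (Niter n * (Teq n + (s n + 1) * 2 ^ s n)) := hT'
    _ ≤ 40 * ((C * (1 / p n * L ^ a)) * (3 * L * G)) := by
        gcongr
        have : (Teq n : ℝ) ≤ (s n + 1) * Teq n :=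
          le_mul_of_one_le_left hTeq (by linarith [Nat.cast_nonneg (α := ℝ) (s n)])
        calc (Teq n : ℝ) + (s n + 1) * 2 ^ s n ≤ (s n + 1) * G := by rw [hG, mul_add]; linarith
          _ ≤ 3 * L * G := mul_le_mul_of_nonneg_right hl2 (by linarith)
    _ = 120 * C * (G / p n * L ^ (a + 1)) := by ring

/-! ### The number of errors outside a random set of positions -/

theorem weightN_eq_iff {n s t u : ℕ} (hut : u ≤ t) {e : Fin n → ZMod 2} (he : hammingNorm e = t)
    (P : Pos n s) :
    weightN P e = u ↔ (P.1 ∩ Finset.univ.filter fun j => e j ≠ 0).card = t - u := by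
  have h1 : (P.1ᶜ.filter fun j => e j ≠ 0) = (Finset.univ.filter fun j => e j ≠ 0) \ P.1 := by
    ext j; simp [and_comm]
  have h2 := Finset.card_sdiff_add_card_inter (Finset.univ.filter fun j => e j ≠ 0) P.1
  rw [weightN, h1, Finset.inter_comm]
  have h3 : (Finset.univ.filter fun j => e j ≠ 0).card = t := he
  omega

/-- `P ∩ E` and `P \ E` are chosen independently. This count gives both the law of the number of
errors and the coefficients of the Krawtchouk polynomials. -/
theorem card_filter_inter {α : Type*} [DecidableEq α] {E X : Finset α} (hEX : E ⊆ X) {s a : ℕ}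
    (has : a ≤ s) :
    ((X.powersetCard s).filter fun P => (P ∩ E).card = a).card =
      E.card.choose a * (X \ E).card.choose (s - a) := by
  rw [← Finset.card_powersetCard, ← Finset.card_powersetCard, ← Finset.card_product]
  refine Finset.card_nbij' (fun P => (P ∩ E, P \ E)) (fun q => q.1 ∪ q.2) ?_ ?_ ?_ ?_
  · intro P hP
    simp only [Finset.coe_filter, Finset.mem_powersetCard, Set.mem_ofPred_eq] at hP
    simp only [Finset.coe_product, Set.mem_prod, Finset.mem_coe, Finset.mem_powersetCard]
    have := Finset.card_inter_add_card_sdiff P E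
    exact ⟨⟨Finset.inter_subset_right, hP.2⟩, Finset.sdiff_subset_sdiff hP.1.1 subset_rfl,
      by omega⟩
  · rintro ⟨A, B⟩ hq
    simp only [Finset.coe_product, Set.mem_prod, Finset.mem_coe, Finset.mem_powersetCard] at hq
    obtain ⟨⟨hA, hA'⟩, hB, hB'⟩ := hq
    have hBE : Disjoint B E := Finset.disjoint_of_subset_left hB Finset.sdiff_disjoint
    have hd : Disjoint A B := (Finset.disjoint_of_subset_right hA hBE).symm
    simp only [Finset.coe_filter, Finset.mem_powersetCard, Set.mem_ofPred_eq]
    have hi : (A ∪ B) ∩ E = A := by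
      rw [Finset.union_inter_distrib_right, Finset.inter_eq_left.2 hA,
        Finset.disjoint_iff_inter_eq_empty.1 hBE, Finset.union_empty]
    rw [hi, Finset.card_union_of_disjoint hd]
    exact ⟨⟨Finset.union_subset (hA.trans hEX) (hB.trans Finset.sdiff_subset), by omega⟩, hA'⟩
  · intro P _
    simp only [Finset.union_comm (P ∩ E), Finset.sdiff_union_inter]
  · rintro ⟨A, B⟩ hq
    simp only [Finset.coe_product, Set.mem_prod, Finset.mem_coe, Finset.mem_powersetCard] at hq
    obtain ⟨⟨hA, -⟩, hB, -⟩ := hq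
    have hBE : Disjoint B E := Finset.disjoint_of_subset_left hB Finset.sdiff_disjoint
    refine Prod.ext ?_ ?_
    · simp only [Finset.union_inter_distrib_right, Finset.inter_eq_left.2 hA,
        Finset.disjoint_iff_inter_eq_empty.1 hBE, Finset.union_empty]
    · simp only [Finset.union_sdiff_distrib, Finset.sdiff_eq_empty_iff_subset.2 hA,
        Finset.empty_union, Finset.sdiff_eq_self_of_disjoint hBE]

/-- Both sides are the multinomial coefficient of (a, b, u, r). These count the errors and
non-errors inside 𝒫 (a, b) and outside (u, r); the identity exchanges the roles of 𝒫 and of the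
support of e. -/
theorem choose_mul_choose_symm (a b u r : ℕ) :
    ((a + u).choose a * (b + r).choose b : ℝ) * ((a + u) + (b + r)).choose (a + u) =
      ((a + b).choose a * (u + r).choose u : ℝ) * ((a + b) + (u + r)).choose (a + b) := by
  simp only [Nat.cast_add_choose]
  rw [show a + u + (b + r) = a + b + (u + r) by ring]
  have h : ∀ i : ℕ, (i.factorial : ℝ) ≠ 0 := fun i => Nat.cast_ne_zero.2 (Nat.factorial_ne_zero i)
  have h1 := h a
  have h2 := h b
  have h3 := h u
  have h4 := h r
  have h5 := h (a + u)
  have h6 := h (b + r)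
  have h7 := h (a + b)
  have h8 := h (u + r)
  field_simp

theorem card_pos (n s : ℕ) : Fintype.card (Pos n s) = n.choose s := by
  rw [Fintype.card_finset_len, Fintype.card_fin]

theorem nonempty_pos {n s : ℕ} (hs : s ≤ n) : Nonempty (Pos n s) :=
  Fintype.card_pos_iff.1 (by rw [card_pos]; exact Nat.choose_pos hs)

theorem card_weightN_eq {n s t u : ℕ} (hs : s ≤ n) (hut : u ≤ t) (hun : u ≤ n - s)
    {e : Fin n → ZMod 2} (he : hammingNorm e = t) :
    ((Finset.univ.filter fun P : Pos n s => weightN P e = u).card : ℝ) =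
      pSucc n s t u * n.choose s := by
  have h0 : (Finset.univ.filter fun P : Pos n s => weightN P e = u).card =
      (((Finset.univ : Finset (Fin n)).powersetCard s).filter fun P =>
        (P ∩ Finset.univ.filter fun j => e j ≠ 0).card = t - u).card := by
    rw [← Finset.card_map (Function.Embedding.subtype _)]
    congr 1
    ext P
    simp only [Finset.mem_map, Finset.mem_filter, Finset.mem_univ, true_and,
      Function.Embedding.subtype_apply, Finset.mem_powersetCard, Finset.subset_univ]
    constructor
    · rintro ⟨Q, hQ, rfl⟩
      exact ⟨Q.2, (weightN_eq_iff hut he Q).1 hQ⟩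
    · rintro ⟨h1, h2⟩
      exact ⟨⟨P, h1⟩, (weightN_eq_iff hut he ⟨P, h1⟩).2 h2, rfl⟩
  have hE : (Finset.univ.filter fun j => e j ≠ 0).card = t := he
  have htn : t ≤ n := by
    rw [← hE]
    exact (Finset.card_le_univ _).trans (Fintype.card_fin n).le
  rw [h0]
  by_cases has : t - u ≤ s
  · rw [card_filter_inter (Finset.subset_univ _) has, Finset.card_univ_sdiff, hE, Fintype.card_fin]
    obtain ⟨a, rfl⟩ : ∃ a, t = a + u := ⟨t - u, by omega⟩
    rw [Nat.add_sub_cancel] at has ⊢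
    obtain ⟨b, rfl⟩ : ∃ b, s = a + b := ⟨s - a, by omega⟩
    obtain ⟨r, rfl⟩ : ∃ r, n = a + b + (u + r) := ⟨n - (a + b + u), by omega⟩
    have key := choose_mul_choose_symm a b u r
    rw [pSucc]
    rw [show a + b + (u + r) - (a + u) = b + r by omega, show a + b - a = b by omega,
      show a + b + (u + r) - (a + b) = u + r by omega, Nat.add_sub_cancel]
    rw [show a + u + (b + r) = a + b + (u + r) by ring] at key
    have hne : ((a + b + (u + r)).choose (a + u) : ℝ) ≠ 0 :=
      Nat.cast_ne_zero.2 (Nat.choose_pos htn).ne'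
    rw [div_mul_eq_mul_div, eq_div_iff hne, ← key]
    push_cast
    ring
  · rw [pSucc, Nat.choose_eq_zero_of_lt (not_le.1 has)]
    simp only [Nat.cast_zero, zero_mul, zero_div, Nat.cast_eq_zero, Finset.card_eq_zero]
    refine Finset.filter_eq_empty_iff.2 fun P hP h => has ?_
    rw [← h, ← (Finset.mem_powersetCard.1 hP).2]
    exact Finset.card_le_card Finset.inter_subset_left

theorem uniformPos_weightN_eq {n s t u : ℕ} (hs : s ≤ n) (hut : u ≤ t) (hun : u ≤ n - s)
    {e : Fin n → ZMod 2} (he : hammingNorm e = t) :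
    (uniformPos hs).toOuterMeasure {P | weightN P e = u} = ENNReal.ofReal (pSucc n s t u) := by
  classical
  have hpos : (0 : ℝ) < n.choose s := Nat.cast_pos.2 (Nat.choose_pos hs)
  have h := ((div_eq_iff hpos.ne').2 (card_weightN_eq hs hut hun he)).symm
  have := nonempty_pos hs
  rw [uniformPos, PMF.toOuterMeasure_uniformOfFintype_apply, h, ENNReal.ofReal_div_of_pos hpos,
    ENNReal.ofReal_natCast, ENNReal.ofReal_natCast, card_pos]
  congr 2
  rw [Fintype.card_subtype]
  rfl

theorem pSucc_le_one {n s t u : ℕ} (hs : s ≤ n) (hut : u ≤ t) (hun : u ≤ n - s)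
    {e : Fin n → ZMod 2} (he : hammingNorm e = t) : pSucc n s t u ≤ 1 := by
  have hpos : (0 : ℝ) < n.choose s := Nat.cast_pos.2 (Nat.choose_pos hs)
  refine le_of_mul_le_mul_right ?_ hpos
  rw [← card_weightN_eq hs hut hun he, one_mul, ← card_pos]
  exact_mod_cast Finset.card_le_univ _

/-! ### Expectations over finite types -/

/-- The expectation of `f` under the law `p` on a finite type. -/
def ex {α : Type} [Fintype α] (p : PMF α) (f : α → ℝ) : ℝ := ∑ x, (p x).toReal * f x

section ex

variable {α β : Type} [Fintype α] [Fintype β] (p : PMF α)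

theorem sum_toReal : ∑ x, (p x).toReal = 1 := by
  have h : ∑ x, p x = 1 := by rw [← p.tsum_coe, tsum_fintype]
  rw [← ENNReal.toReal_sum fun x _ => p.apply_ne_top x, h, ENNReal.toReal_one]

theorem ex_const (c : ℝ) : ex p (fun _ => c) = c := by
  rw [ex, ← Finset.sum_mul, sum_toReal, one_mul]

theorem ex_mono {f g : α → ℝ} (h : ∀ x, f x ≤ g x) : ex p f ≤ ex p g :=
  Finset.sum_le_sum fun x _ => mul_le_mul_of_nonneg_left (h x) ENNReal.toReal_nonneg

theorem ex_nonneg {f : α → ℝ} (h : ∀ x, 0 ≤ f x) : 0 ≤ ex p f :=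
  Finset.sum_nonneg fun x _ => mul_nonneg ENNReal.toReal_nonneg (h x)

theorem ex_add (f g : α → ℝ) : ex p (fun x => f x + g x) = ex p f + ex p g := by
  simp only [ex, mul_add, Finset.sum_add_distrib]

theorem ex_sub (f g : α → ℝ) : ex p (fun x => f x - g x) = ex p f - ex p g := by
  simp only [ex, mul_sub, Finset.sum_sub_distrib]

theorem ex_const_mul (c : ℝ) (f : α → ℝ) : ex p (fun x => c * f x) = c * ex p f := by
  simp only [ex, Finset.mul_sum]
  exact Finset.sum_congr rfl fun x _ => by ring

theorem ex_mul_const (c : ℝ) (f : α → ℝ) : ex p (fun x => f x * c) = ex p f * c := by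
  simp only [mul_comm _ c, ex_const_mul]

theorem ex_sum {ι : Type*} (S : Finset ι) (f : ι → α → ℝ) :
    ex p (fun x => ∑ i ∈ S, f i x) = ∑ i ∈ S, ex p (f i) := by
  simp only [ex, Finset.mul_sum]
  exact Finset.sum_comm

theorem ex_pure (a : α) (f : α → ℝ) : ex (PMF.pure a) f = f a := by
  classical
  rw [ex, Finset.sum_eq_single a]
  · simp
  · intro b _ hb
    simp [PMF.pure_apply, hb]
  · simp

theorem ex_bind (q : α → PMF β) (f : β → ℝ) : ex (p.bind q) f = ex p fun a => ex (q a) f := by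
  simp only [ex, PMF.bind_apply, tsum_fintype, Finset.mul_sum]
  rw [Finset.sum_comm]
  refine Finset.sum_congr rfl fun b _ => ?_
  rw [ENNReal.toReal_sum fun a _ =>
    ENNReal.mul_ne_top (p.apply_ne_top a) ((q a).apply_ne_top b), Finset.sum_mul]
  exact Finset.sum_congr rfl fun a _ => by rw [ENNReal.toReal_mul, mul_assoc]

theorem ex_map (g : α → β) (f : β → ℝ) : ex (p.map g) f = ex p fun a => f (g a) := by
  rw [PMF.map, ex_bind]
  simp only [Function.comp, ex_pure]

theorem ex_uniform [Nonempty α] (f : α → ℝ) :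
    ex (PMF.uniformOfFintype α) f = (∑ x, f x) / Fintype.card α := by
  simp only [ex, PMF.uniformOfFintype_apply, ENNReal.toReal_inv, ENNReal.toReal_natCast]
  rw [← Finset.mul_sum, div_eq_inv_mul]

open Classical in
theorem toOuterMeasure_eq_ex (S : Set α) :
    p.toOuterMeasure S = ENNReal.ofReal (ex p fun x => if x ∈ S then 1 else 0) := by
  rw [PMF.toOuterMeasure_apply_fintype, ex, ENNReal.ofReal_sum_of_nonneg]
  · refine Finset.sum_congr rfl fun x _ => ?_
    by_cases h : x ∈ S
    · simp [h, ENNReal.ofReal_toReal (p.apply_ne_top x)]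
    · simp [h]
  · intro x _
    split_ifs <;> simp

theorem ex_iid_succ (m : ℕ) (f : (Fin (m + 1) → α) → ℝ) :
    ex (iid p (m + 1)) f = ex p fun a => ex (iid p m) fun v => f (Fin.cons a v) := by
  simp only [iid, ex_bind, ex_map]

theorem ex_iid_prod (g : α → ℝ) (m : ℕ) :
    ex (iid p m) (fun v => ∏ i, g (v i)) = ex p g ^ m := by
  induction m with
  | zero => simp [ex_const]
  | succ m ih =>
    rw [ex_iid_succ]
    simp only [Fin.prod_univ_succ, Fin.cons_zero, Fin.cons_succ, ex_const_mul, ih, ex_mul_const]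
    rw [pow_succ']

open Classical in
/-- The Chernoff bound. -/
theorem ex_iid_sum_ge (Y : α → ℝ) (m : ℕ) (θ r : ℝ) :
    ex (iid p m) (fun v => if θ ≤ r * ∑ i, Y (v i) then (1 : ℝ) else 0) ≤
      Real.exp (-θ) * ex p (fun a => Real.exp (r * Y a)) ^ m := by
  rw [← ex_iid_prod, ← ex_const_mul]
  refine ex_mono _ fun v => ?_
  rw [← Real.exp_sum, ← Finset.mul_sum, ← Real.exp_add]
  split_ifs with h
  · exact Real.one_le_exp (by linarith)
  · exact (Real.exp_pos _).le

end ex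

/-! ### The outer loop in the probabilistic model -/

open Classical in
-- With F_m the failure probability, an iteration errs with probability at most b, succeeds with
-- probability at least g, and otherwise passes on, so F_(m+1) ≤ b + (1-g)F_m. The fixed point of
-- this recursion is b/g.
theorem decoderVal_fail_le {n s N : ℕ} (δ : ℝ) (e : Fin n → ZMod 2)
    (p : PMF (Pos n s × (Fin N → Sample s))) {g b : ℝ} (hg0 : 0 < g)
    (hg : g ≤ ex p fun q => if solveVal δ q.2 = some (onP q.1 e) then 1 else 0)
    (hb : ex p (fun q => if ∃ x ≠ onP q.1 e, solveVal δ q.2 = some x then 1 else 0) ≤ b)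
    (m : ℕ) :
    ex (iid p m) (fun it => if IsCorrect e (decoderVal δ (List.ofFn it)) then (0 : ℝ) else 1) ≤
      (1 - g) ^ m + b / g := by
  have hb0 : 0 ≤ b := (ex_nonneg p fun q => by split_ifs <;> norm_num).trans hb
  induction m with
  | zero =>
    rw [pow_zero]
    have h1 := ex_mono (iid p 0) (f := fun it =>
      if IsCorrect e (decoderVal δ (List.ofFn it)) then (0 : ℝ) else 1) (g := fun _ => 1)
      fun it => by split_ifs <;> norm_num
    rw [ex_const] at h1
    have : 0 ≤ b / g := by positivity
    linarith
  | succ m ih =>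
    rw [ex_iid_succ]
    set F := ex (iid p m) (fun it => if IsCorrect e (decoderVal δ (List.ofFn it)) then (0 : ℝ)
      else 1) with hF
    have hF0 : 0 ≤ F := ex_nonneg _ fun it => by split_ifs <;> norm_num
    have hF1 : F ≤ 1 := by
      have h1 := ex_mono (iid p m) (f := fun it =>
        if IsCorrect e (decoderVal δ (List.ofFn it)) then (0 : ℝ) else 1) (g := fun _ => 1)
        fun it => by split_ifs <;> norm_num
      rwa [ex_const] at h1
    have key : ∀ q : Pos n s × (Fin N → Sample s), ex (iid p m) (fun it =>
        if IsCorrect e (decoderVal δ (List.ofFn (Fin.cons q it : Fin (m + 1) → _))) then (0 : ℝ)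
          else 1) ≤
        (if ∃ x ≠ onP q.1 e, solveVal δ q.2 = some x then 1 else 0) +
          (F - (if solveVal δ q.2 = some (onP q.1 e) then 1 else 0) * F) := by
      rintro ⟨P, smp⟩
      simp only [List.ofFn_succ, Fin.cons_zero, Fin.cons_succ, decoderVal]
      cases hv : solveVal δ smp with
      | none =>
        simp only [reduceCtorEq, and_false, exists_false, if_false, zero_mul, sub_zero, zero_add]
        exact le_of_eq hF.symm
      | some x =>
        by_cases hx : x = onP P e
        · subst hx
          have hc : IsCorrect e (some (P, onP P e)) := ⟨P, rfl⟩
          simp [hc, ex_const]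
        · have h1 : ∃ x' ≠ onP P e, some x = some x' := ⟨x, hx, rfl⟩
          have h2 : some x ≠ some (onP P e) := fun h => hx (Option.some.inj h)
          rw [if_pos h1, if_neg h2]
          simp only
          split_ifs <;> rw [ex_const] <;> linarith
    refine (ex_mono p key).trans ?_
    rw [ex_add, ex_sub, ex_const, ex_mul_const]
    have h1 : (1 - g) * F ≤ (1 - g) * ((1 - g) ^ m + b / g) := by
      refine mul_le_mul_of_nonneg_left ih ?_
      have h2 := ex_mono p (f := fun q => if solveVal δ q.2 = some (onP q.1 e) then (1 : ℝ) else 0)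
        (g := fun _ => 1) fun it => by split_ifs <;> norm_num
      rw [ex_const] at h2
      linarith
    have h3 : (1 - g) * ((1 - g) ^ m + b / g) + b = (1 - g) ^ (m + 1) + b / g := by
      field_simp
      ring
    have h4 := mul_le_mul_of_nonneg_right hg hF0
    linarith

/-! ### The Fourier transform of the log-likelihood function -/

/-- The sign `(-1)^b`. -/
def sgn (b : ZMod 2) : ℝ := (-1) ^ b.val

theorem sgn_zero : sgn 0 = 1 := by simp [sgn]

theorem sgn_one : sgn 1 = -1 := by simp [sgn, ZMod.val_one]

theorem sgn_add (a b : ZMod 2) : sgn (a + b) = sgn a * sgn b := neg_one_pow_val_add a b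

theorem zmod_two_cases (b : ZMod 2) : b = 0 ∨ b = 1 := by revert b; decide

theorem sgn_mul_self (b : ZMod 2) : sgn b * sgn b = 1 := by
  rcases zmod_two_cases b with rfl | rfl <;> simp [sgn_zero, sgn_one]

theorem exp_mul_sgn (c : ℝ) (b : ZMod 2) :
    Real.exp (c * sgn b) = Real.cosh c + sgn b * Real.sinh c := by
  rcases zmod_two_cases b with rfl | rfl
  · rw [sgn_zero, mul_one, one_mul, Real.cosh_add_sinh]
  · rw [sgn_one, mul_neg_one, neg_one_mul, ← sub_eq_add_neg, Real.cosh_sub_sinh]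

/-- The agreement of the word `x` with a sample. -/
def agreement {s : ℕ} (x : Word s) (q : Sample s) : ℝ := sgn (dotProduct x q.1 + q.2)

theorem log_pFlip {δ : ℝ} (hδ : |δ| < 1) (b : ZMod 2) :
    0 < pFlip δ b ∧ 0 < 1 - pFlip δ b ∧
      Real.log ((1 - pFlip δ b) / pFlip δ b) = sgn b * Real.log ((1 + δ) / (1 - δ)) := by
  obtain ⟨h1, h2⟩ := abs_lt.1 hδ
  have h3 : (0 : ℝ) < 1 + δ := by linarith
  have h4 : (0 : ℝ) < 1 - δ := by linarith
  rcases zmod_two_cases b with rfl | rfl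
  · have h : pFlip δ 0 = (1 - δ) / 2 := if_pos rfl
    rw [h, sgn_zero, one_mul]
    refine ⟨by linarith, by linarith, ?_⟩
    congr 1
    field_simp
    ring
  · have h : pFlip δ 1 = 1 - (1 - δ) / 2 := if_neg one_ne_zero
    rw [h, sgn_one, neg_one_mul, ← Real.log_inv, inv_div]
    refine ⟨by linarith, by linarith, ?_⟩
    congr 1
    rw [show 1 - (1 - δ) / 2 = (1 + δ) / 2 by ring]
    field_simp
    ring

/-- With p = A/(A+B), the odds (1-p)/p are B/A, a product over the samples; |δ| < 1 keeps all
factors positive. -/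
theorem llr_eq_sum {s N : ℕ} {δ : ℝ} (hδ : |δ| < 1) (smp : Fin N → Sample s) (a : Word s) :
    llr δ smp a = ∑ i with (smp i).1 = a, sgn (smp i).2 * Real.log ((1 + δ) / (1 - δ)) := by
  rw [llr_eq, pOne]
  set A := ∏ i with (smp i).1 = a, pFlip δ (smp i).2 with hA
  set B := ∏ i with (smp i).1 = a, (1 - pFlip δ (smp i).2) with hB
  have hA0 : 0 < A := Finset.prod_pos fun i _ => (log_pFlip hδ _).1
  have hB0 : 0 < B := Finset.prod_pos fun i _ => (log_pFlip hδ _).2.1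
  have h : (1 - A / (A + B)) / (A / (A + B)) = B / A := by
    field_simp
    ring
  rw [h, hA, hB, ← Finset.prod_div_distrib, Real.log_prod]
  · exact Finset.sum_congr rfl fun i _ => (log_pFlip hδ _).2.2
  · intro i _
    exact (div_pos (log_pFlip hδ _).2.1 (log_pFlip hδ _).1).ne'

/-- After exchanging the sums, each sample counts once, at its own `a`; repetitions of `a` play no
special role. -/
theorem fourier_llr {s N : ℕ} {δ : ℝ} (hδ : |δ| < 1) (smp : Fin N → Sample s) (x : Word s) :
    fourier (llr δ smp) x = Real.log ((1 + δ) / (1 - δ)) * ∑ i, agreement x (smp i) := by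
  unfold fourier
  simp only [llr_eq_sum hδ, Finset.sum_filter]
  simp only [Finset.sum_mul, Finset.mul_sum]
  rw [Finset.sum_comm]
  refine Finset.sum_congr rfl fun i _ => ?_
  rw [Finset.sum_eq_single (smp i).1]
  · rw [if_pos rfl, agreement, sgn_add]
    simp only [sgn]
    ring
  · intro a _ ha
    rw [if_neg ha.symm, zero_mul]
  · simp

/-- The logarithm has the sign of δ, so for δ < 0 the inequality is reversed twice. The resulting
form treats both signs of δ alike. -/
theorem threshold_le_iff {s N : ℕ} {δ : ℝ} (hδ : |δ| < 1) (hδ0 : δ ≠ 0)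
    (smp : Fin N → Sample s) (x : Word s) :
    threshold δ N ≤ fourier (llr δ smp) x ↔
      δ ^ 2 * N / 2 ≤ δ * ∑ i, agreement x (smp i) := by
  rw [fourier_llr hδ, threshold]
  set S := ∑ i, agreement x (smp i)
  set L := Real.log ((1 + δ) / (1 - δ)) with hL
  obtain ⟨h1, h2⟩ := abs_lt.1 hδ
  rcases lt_or_gt_of_ne hδ0 with h | h
  · have hL0 : L < 0 := Real.log_neg (div_pos (by linarith) (by linarith))
      (by rw [div_lt_one (by linarith)]; linarith)
    rw [mul_comm _ L, mul_le_mul_left_of_neg hL0,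
      show δ ^ 2 * (N : ℝ) / 2 = δ * (δ * N / 2) by ring, mul_le_mul_left_of_neg h]
  · have hL0 : 0 < L := Real.log_pos (by rw [lt_div_iff₀ (by linarith)]; linarith)
    rw [mul_comm _ L, mul_le_mul_iff_right₀ hL0,
      show δ ^ 2 * (N : ℝ) / 2 = δ * (δ * N / 2) by ring, mul_le_mul_iff_right₀ h]

/-! ### The LPN oracle -/

theorem ex_bernoulliBias {ε : ℝ} (hε : |ε| ≤ 1) (f : ZMod 2 → ℝ) :
    ex (bernoulliBias ε hε) f = (1 + ε) / 2 * f 0 + (1 - ε) / 2 * f 1 := by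
  obtain ⟨h1, h2⟩ := abs_le.1 hε
  have h : ∀ f : ZMod 2 → ℝ, ∑ b, f b = f 0 + f 1 := fun f => Fin.sum_univ_two f
  rw [ex, h]
  have h10 : (1 : ZMod 2) ≠ 0 := one_ne_zero
  simp only [bernoulliBias, PMF.ofFintype_apply, if_true, if_neg h10]
  rw [ENNReal.toReal_ofReal (by linarith), ENNReal.toReal_ofReal (by linarith)]

/-- Translating `a` by a unit vector on the support of `x` changes the sign of every term. -/
theorem sum_sgn_dotProduct {s : ℕ} {x : Word s} (hx : x ≠ 0) :
    ∑ a : Word s, sgn (dotProduct x a) = 0 := by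
  obtain ⟨l, hl⟩ := Function.ne_iff.1 hx
  have hl1 : x l = 1 := zmod_two_ne_zero hl
  have h := Equiv.sum_comp (Equiv.addRight (Pi.single l 1 : Word s))
    fun a => sgn (dotProduct x a)
  simp only [Equiv.coe_addRight, dotProduct_add, dotProduct_single, hl1, mul_one, sgn_add, sgn_one,
    mul_neg, Finset.sum_neg_distrib] at h
  linarith

/-- Averaging over the noise leaves ε(-1)^⟨x+y,a⟩, whose mean over `a` vanishes unless y = x. -/
theorem ex_agreement {s : ℕ} (x y : Word s) {ε : ℝ} (hε : |ε| ≤ 1) :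
    ex (lpnOracle x ε hε) (agreement y) = if y = x then ε else 0 := by
  have key : ∀ a : Word s, ex ((bernoulliBias ε hε).map fun η => (a, dotProduct x a + η))
      (agreement y) = ε * sgn (dotProduct (y + x) a) := by
    intro a
    rw [ex_map, ex_bernoulliBias]
    simp only [agreement, ← add_assoc, sgn_add, sgn_zero, sgn_one, add_dotProduct]
    ring
  rw [lpnOracle, ex_bind]
  simp only [key]
  rw [ex_const_mul, ex_uniform]
  split_ifs with h
  · subst h
    have h0 : y + y = 0 := funext fun l => CharTwo.add_self_eq_zero (y l)
    simp [h0, sgn_zero]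
  · rw [sum_sgn_dotProduct, zero_div, mul_zero]
    intro h0
    apply h
    funext l
    rw [← sub_eq_zero, CharTwo.sub_eq_add]
    exact congrFun h0 l

theorem ex_exp_agreement {s : ℕ} (x y : Word s) {ε : ℝ} (hε : |ε| ≤ 1) (c : ℝ) :
    ex (lpnOracle x ε hε) (fun q => Real.exp (c * agreement y q)) =
      Real.cosh c + (if y = x then ε else 0) * Real.sinh c := by
  simp only [agreement, exp_mul_sgn]
  rw [ex_add, ex_const, ex_mul_const, ← ex_agreement x y hε]
  rfl

open Classical in
-- The signs for `y` are unbiased, so ε does not enter. The Chernoff parameter δ/2 gives the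
-- exponent Nδ²(-1/4 + 1/8), the best possible with cosh c ≤ exp(c²/2).
theorem ex_false_le {s : ℕ} (x : Word s) {y : Word s} (hy : y ≠ x) {ε : ℝ} (hε : |ε| ≤ 1) (N : ℕ)
    (δ : ℝ) :
    ex (iid (lpnOracle x ε hε) N) (fun smp =>
      if δ ^ 2 * N / 2 ≤ δ * ∑ i, agreement y (smp i) then (1 : ℝ) else 0) ≤
      Real.exp (-(N * δ ^ 2 / 8)) := by
  have h := ex_iid_sum_ge (lpnOracle x ε hε) (agreement y) N (δ ^ 2 * N / 4) (δ / 2)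
  have h2 : ∀ smp : Fin N → Sample s, (δ ^ 2 * N / 4 ≤ δ / 2 * ∑ i, agreement y (smp i)) ↔
      δ ^ 2 * N / 2 ≤ δ * ∑ i, agreement y (smp i) := fun smp => by
    constructor <;> intro h <;> linarith
  simp only [h2] at h
  refine h.trans ?_
  rw [ex_exp_agreement, if_neg hy, zero_mul, add_zero]
  calc Real.exp (-(δ ^ 2 * N / 4)) * Real.cosh (δ / 2) ^ N
      ≤ Real.exp (-(δ ^ 2 * N / 4)) * Real.exp ((δ / 2) ^ 2 / 2) ^ N := by
        gcongr
        exact Real.cosh_le_exp_half_sq _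
    _ = Real.exp (-(N * δ ^ 2 / 8)) := by
        rw [← Real.exp_nat_mul, ← Real.exp_add]
        congr 1
        ring

/-- In units of δ²/64: cosh(δ/8) exceeds 1 by at most 1, and ε·sinh(δ/8) ≥ εδ/8 is at least 6, which
leaves 1 - 5. -/
theorem cosh_sub_le {δ ε : ℝ} (hδ : |δ| < 1) (hε : 3 / 4 * δ ^ 2 ≤ δ * ε) :
    Real.cosh (-(δ / 8)) + ε * Real.sinh (-(δ / 8)) ≤ Real.exp (-(5 / 64 * δ ^ 2)) := by
  have hδ2 : δ ^ 2 ≤ 1 := (sq_le_one_iff_abs_le_one δ).2 hδ.le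
  have h1 : Real.cosh (δ / 8) ≤ 1 + (δ / 8) ^ 2 := by
    refine (Real.cosh_le_exp_half_sq _).trans ?_
    have h0 : 0 ≤ (δ / 8) ^ 2 / 2 := by positivity
    have := Real.abs_exp_sub_one_le (x := (δ / 8) ^ 2 / 2) (by
      rw [abs_of_nonneg h0]; nlinarith)
    rw [abs_of_nonneg h0] at this
    linarith [le_abs_self (Real.exp ((δ / 8) ^ 2 / 2) - 1)]
  have h2 : ε * (δ / 8) ≤ ε * Real.sinh (δ / 8) := by
    rcases lt_trichotomy δ 0 with h | h | h
    · have hε0 : ε ≤ 0 := by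
        by_contra h'
        have : δ * ε < 0 := mul_neg_of_neg_of_pos h (not_le.1 h')
        nlinarith [sq_nonneg δ]
      have : Real.sinh (δ / 8) ≤ δ / 8 := Real.sinh_le_self_iff.2 (by linarith)
      exact mul_le_mul_of_nonpos_left this hε0
    · simp [h]
    · have hε0 : 0 ≤ ε := by
        by_contra h'
        have : δ * ε < 0 := mul_neg_of_pos_of_neg h (not_le.1 h')
        nlinarith [sq_nonneg δ]
      have : δ / 8 ≤ Real.sinh (δ / 8) := Real.self_le_sinh_iff.2 (by linarith)
      exact mul_le_mul_of_nonneg_left this hε0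
  rw [Real.cosh_neg, Real.sinh_neg]
  have h3 := Real.add_one_le_exp (-(5 / 64 * δ ^ 2))
  nlinarith

open Classical in
theorem ex_true_fail_le {s : ℕ} (x : Word s) {δ ε : ℝ} (hδ : |δ| < 1) (hε : |ε| ≤ 1)
    (hεδ : 3 / 4 * δ ^ 2 ≤ δ * ε) (N : ℕ) :
    ex (iid (lpnOracle x ε hε) N) (fun smp =>
      if δ ^ 2 * N / 2 ≤ δ * ∑ i, agreement x (smp i) then (0 : ℝ) else 1) ≤
      Real.exp (-(N * δ ^ 2 / 64)) := by
  -- Lower tail, hence the negative parameter; the exponent is Nδ²(4/64 - 5/64).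
  have h := ex_iid_sum_ge (lpnOracle x ε hε) (agreement x) N (-(δ ^ 2 * N / 16)) (-(δ / 8))
  refine le_trans (ex_mono _ fun smp => ?_) (h.trans ?_)
  · split_ifs with h1 h2 h2
    · norm_num
    · norm_num
    · norm_num
    · exfalso
      apply h2
      linarith [not_le.1 h1]
  rw [ex_exp_agreement, if_pos rfl, neg_neg]
  have h0 : 0 ≤ Real.cosh (-(δ / 8)) + ε * Real.sinh (-(δ / 8)) := by
    have := ex_nonneg (lpnOracle x ε hε) (f := fun q => Real.exp (-(δ / 8) * agreement x q))
      fun q => (Real.exp_pos _).le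
    rwa [ex_exp_agreement, if_pos rfl] at this
  calc _ ≤ Real.exp (δ ^ 2 * N / 16) * Real.exp (-(5 / 64 * δ ^ 2)) ^ N := by
        gcongr
        exact cosh_sub_le hδ hεδ
    _ = Real.exp (-(N * δ ^ 2 / 64)) := by
        rw [← Real.exp_nat_mul, ← Real.exp_add]
        congr 1
        ring

open Classical in
theorem ex_solveVal_wrong_le {s : ℕ} (x : Word s) {δ ε : ℝ} (hδ : |δ| < 1) (hδ0 : δ ≠ 0)
    (hε : |ε| ≤ 1) (N : ℕ) :
    ex (iid (lpnOracle x ε hε) N) (fun smp =>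
      if ∃ y ≠ x, threshold δ N ≤ fourier (llr δ smp) y then (1 : ℝ) else 0) ≤
      2 ^ s * Real.exp (-(N * δ ^ 2 / 8)) := by
  have h1 : ∀ smp : Fin N → Sample s,
      (if ∃ y ≠ x, threshold δ N ≤ fourier (llr δ smp) y then (1 : ℝ) else 0) ≤
      ∑ y ∈ Finset.univ.erase x,
        if δ ^ 2 * N / 2 ≤ δ * ∑ i, agreement y (smp i) then (1 : ℝ) else 0 := by
    intro smp
    split_ifs with h
    · obtain ⟨y, hy, hy'⟩ := h
      rw [threshold_le_iff hδ hδ0] at hy'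
      refine le_trans ?_ (Finset.single_le_sum (f := fun y =>
        if δ ^ 2 * N / 2 ≤ δ * ∑ i, agreement y (smp i) then (1 : ℝ) else 0)
        (fun y _ => by split_ifs <;> norm_num) (Finset.mem_erase.2 ⟨hy, Finset.mem_univ y⟩))
      simp only [if_pos hy', le_refl]
    · exact Finset.sum_nonneg fun y _ => by split_ifs <;> norm_num
  refine (ex_mono _ h1).trans ?_
  rw [ex_sum]
  refine (Finset.sum_le_card_nsmul _ _ _ fun y hy =>
    ex_false_le x (Finset.ne_of_mem_erase hy) hε N δ).trans ?_
  rw [nsmul_eq_mul]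
  refine mul_le_mul_of_nonneg_right ?_ (Real.exp_pos _).le
  have : (Finset.univ.erase x).card ≤ 2 ^ s :=
    (Finset.card_le_univ _).trans (by simp [ZMod.card])
  exact_mod_cast this

theorem le_of_solveVal_eq_some {s N : ℕ} {δ : ℝ} {smp : Fin N → Sample s} {x : Word s}
    (h : solveVal δ smp = some x) : threshold δ N ≤ fourier (llr δ smp) x := by
  rcases iterSpec_solveVal δ smp with ⟨h', -⟩ | ⟨y, hy, -, hy'⟩
  · rw [h] at h'
    cases h'
  · rw [h] at hy
    rwa [Option.some.inj hy]

theorem solveVal_eq_some {s N : ℕ} {δ : ℝ} {smp : Fin N → Sample s} {x : Word s}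
    (hx : threshold δ N ≤ fourier (llr δ smp) x)
    (h : ¬∃ y ≠ x, threshold δ N ≤ fourier (llr δ smp) y) : solveVal δ smp = some x := by
  rcases iterSpec_solveVal δ smp with ⟨-, h'⟩ | ⟨y, hy, -, hy'⟩
  · exact absurd hx (not_le.2 (h' x))
  · rw [hy]
    by_contra hne
    exact h ⟨y, fun h => hne (by rw [h]), hy'⟩

/-! ### Homomorphisms of finite groups -/

section fibers

variable {G K : Type*} [AddCommGroup G] [AddCommGroup K] [Fintype G] [Fintype K]

open Classical in
-- The fibres over the range are cosets of the kernel, and `m` is the order of the kernel.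
theorem exists_sum_comp_eq (φ : G →+ K) : ∃ m : ℝ, 0 < m ∧ ∀ f : K → ℝ,
    ∑ g, f (φ g) = m * ∑ k with k ∈ Set.range φ, f k := by
  refine ⟨((Finset.univ.filter fun g => φ g = 0).card : ℝ), ?_, fun f => ?_⟩
  · exact_mod_cast Finset.card_pos.2 ⟨0, by simp⟩
  · rw [Finset.sum_comp f φ, Finset.mul_sum]
    have : (Finset.univ.image φ) = Finset.univ.filter fun k => k ∈ Set.range φ := by
      ext k; simp
    rw [this]
    refine Finset.sum_congr rfl fun k hk => ?_
    obtain ⟨g₀, rfl⟩ := (Finset.mem_filter.1 hk).2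
    rw [nsmul_eq_mul]
    congr 2
    refine Finset.card_nbij' (fun g => g - g₀) (fun g => g + g₀) ?_ ?_ ?_ ?_
    · intro g hg
      simpa [sub_eq_zero] using hg
    · intro g hg
      simpa using hg
    · intro g _
      simp
    · intro g _
      simp

theorem average_comp (φ : G →+ K) (hφ : Function.Surjective φ) (f : K → ℝ) :
    (∑ g, f (φ g)) / Fintype.card G = (∑ k, f k) / Fintype.card K := by
  classical
  obtain ⟨m, hm, h⟩ := exists_sum_comp_eq φ
  have hr : (Finset.univ.filter fun k => k ∈ Set.range φ) = Finset.univ := by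
    simp [hφ.range_eq]
  have h1 := h fun _ => 1
  rw [hr] at h1
  simp only [Finset.sum_const, Finset.card_univ, nsmul_eq_mul, mul_one] at h1
  have hK : (Fintype.card K : ℝ) ≠ 0 := Nat.cast_ne_zero.2 Fintype.card_ne_zero
  rw [h, hr, h1]
  field_simp

end fibers

/-! ### Random linear codes -/

section code

variable {m n : ℕ}

/-- The annihilator of the kernel of a linear map is the range of its dual map, here the row space
of `H`. -/
theorem mem_dual_code_iff (H : Matrix (Fin m) (Fin n) (ZMod 2)) (d : Fin n → ZMod 2) :
    d ∈ dual (code H) ↔ ∃ z, Matrix.vecMul z H = d := by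
  constructor
  · intro hd
    let ψ : Module.Dual (ZMod 2) (Fin n → ZMod 2) := dotProductEquiv (ZMod 2) (Fin n) d
    have hψ : ψ ∈ (LinearMap.ker H.mulVecLin).dualAnnihilator := by
      rw [Submodule.mem_dualAnnihilator]
      intro c hc
      have : dotProduct c d = 0 := hd c hc
      rw [dotProduct_comm] at this
      exact this
    rw [← LinearMap.range_dualMap_eq_dualAnnihilator_ker] at hψ
    obtain ⟨φ, hφ⟩ := hψ
    refine ⟨(dotProductEquiv (ZMod 2) (Fin m)).symm φ, ?_⟩
    apply (dotProductEquiv (ZMod 2) (Fin n)).injective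
    refine LinearMap.ext fun c => ?_
    have h1 := LinearMap.congr_fun hφ c
    have h2 : (dotProductEquiv (ZMod 2) (Fin m)) ((dotProductEquiv (ZMod 2) (Fin m)).symm φ)
      (H.mulVec c) = φ (H.mulVec c) := by rw [LinearEquiv.apply_symm_apply]
    rw [dotProductEquiv_apply_apply] at h2 ⊢
    rw [← Matrix.dotProduct_mulVec, h2]
    exact h1
  · rintro ⟨z, rfl⟩ c hc
    have : H.mulVec c = 0 := hc
    rw [dotProduct_comm, ← Matrix.dotProduct_mulVec, this, dotProduct_zero]

/-- The indicator of the words of weight `w` outside `P`. -/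
def hasWeight {s : ℕ} (w : ℕ) (P : Pos n s) (h : Fin n → ZMod 2) : ℝ :=
  if weightN P h = w then 1 else 0

/-- The sign of `⟨e_𝒩, h_𝒩⟩` if `h` has weight `w` outside `P`, and `0` otherwise. -/
def signedWeight {s : ℕ} (w : ℕ) (e : Fin n → ZMod 2) (P : Pos n s) (h : Fin n → ZMod 2) : ℝ :=
  hasWeight w P h * sgn (dotN P e h)

theorem bias_eq {α : Type} (S : Finset α) (g : α → ZMod 2) :
    bias S g = (∑ h ∈ S, sgn (g h)) / ∑ _h ∈ S, 1 := by
  classical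
  rw [bias, Finset.card_filter, Finset.card_filter, Finset.sum_const, nsmul_eq_mul, mul_one]
  push_cast
  rw [← Finset.sum_sub_distrib]
  congr 1
  refine Finset.sum_congr rfl fun h _ => ?_
  rcases zmod_two_cases (g h) with h0 | h0 <;> simp [h0, sgn_zero, sgn_one]

/-- The rows of `H` may be dependent, but every dual word is then hit by the same number of `z`,
which cancels in the quotient. If there are no checks, both sides are 0/0 = 0. -/
theorem lpnBias_code {s : ℕ} (H : Matrix (Fin m) (Fin n) (ZMod 2)) (w : ℕ)
    (e : Fin n → ZMod 2) (P : Pos n s) :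
    lpnBias (code H) w e P = (∑ z, signedWeight w e P (Matrix.vecMul z H)) /
      ∑ z, hasWeight w P (Matrix.vecMul z H) := by
  classical
  let φ : (Fin m → ZMod 2) →+ (Fin n → ZMod 2) := H.vecMulLinear.toAddMonoidHom
  obtain ⟨c, hc, h⟩ := exists_sum_comp_eq φ
  have key : ∀ g : (Fin n → ZMod 2) → ℝ, ∑ z, hasWeight w P (Matrix.vecMul z H) *
      g (Matrix.vecMul z H) = c * ∑ k ∈ checks (code H) w P, g k := by
    intro g
    refine (h fun k => hasWeight w P k * g k).trans ?_
    congr 1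
    rw [checks, Finset.sum_filter, Finset.sum_filter]
    refine Finset.sum_congr rfl fun k _ => ?_
    rw [mem_dual_code_iff]
    have : k ∈ Set.range φ ↔ ∃ z, Matrix.vecMul z H = k := Iff.rfl
    by_cases h1 : ∃ z, Matrix.vecMul z H = k
    · by_cases h2 : weightN P k = w
      · rw [if_pos (this.2 h1), if_pos ⟨h1, h2⟩, hasWeight, if_pos h2, one_mul]
      · rw [if_pos (this.2 h1), if_neg fun h => h2 h.2, hasWeight, if_neg h2, zero_mul]
    · rw [if_neg fun h => h1 (this.1 h), if_neg fun h => h1 h.1]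
  have k1 := key fun k => sgn (dotN P e k)
  have k2 := key fun _ => 1
  simp only [mul_one] at k2
  simp only [signedWeight]
  rw [k1, k2, mul_div_mul_left _ _ hc.ne', lpnBias, bias_eq]

/-- A unit vector works unless the support of `z` lies strictly inside that of `z'`; then the sum of
a unit vector on the former and one on the difference does. The case z' = 0 is allowed. -/
theorem exists_dotProduct_eq {z z' : Fin m → ZMod 2} (hz : z ≠ 0) (hne : z ≠ z') :
    ∃ v, dotProduct z v = 1 ∧ dotProduct z' v = 0 := by
  by_cases h : ∃ i, z i = 1 ∧ z' i = 0
  · obtain ⟨i, h1, h2⟩ := h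
    exact ⟨Pi.single i 1, by simp [h1], by simp [h2]⟩
  · obtain ⟨i, hi⟩ := Function.ne_iff.1 hz
    obtain ⟨j, hj⟩ := Function.ne_iff.1 hne
    have hi1 : z i = 1 := zmod_two_ne_zero hi
    have hi2 : z' i = 1 := zmod_two_ne_zero fun h0 => h ⟨i, hi1, h0⟩
    have hj1 : z j = 0 := by
      by_contra h1
      have hj1 : z j = 1 := zmod_two_ne_zero h1
      refine h ⟨j, hj1, ?_⟩
      by_contra h2
      exact hj (hj1.trans (zmod_two_ne_zero h2).symm)
    have hj2 : z' j = 1 := zmod_two_ne_zero fun h0 => hj (hj1.trans h0.symm)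
    refine ⟨Pi.single i 1 + Pi.single j 1, ?_, ?_⟩
    · simp [dotProduct_add, hi1, hj1]
    · rw [dotProduct_add, dotProduct_single, dotProduct_single, hi2, hj2]
      decide

/-- The average of a function over all the words. -/
def average (f : (Fin n → ZMod 2) → ℝ) : ℝ := (∑ h, f h) / 2 ^ n

theorem ex_vecMul {z : Fin m → ZMod 2} (hz : z ≠ 0) (f : (Fin n → ZMod 2) → ℝ) :
    ex (PMF.uniformOfFintype (Matrix (Fin m) (Fin n) (ZMod 2))) (fun H => f (Matrix.vecMul z H)) =
      average f := by
  obtain ⟨v, hv, -⟩ := exists_dotProduct_eq hz hz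
  let φ : Matrix (Fin m) (Fin n) (ZMod 2) →+ (Fin n → ZMod 2) :=
    AddMonoidHom.mk' (fun H => Matrix.vecMul z H) fun A B => Matrix.vecMul_add A B z
  have hφ : Function.Surjective φ := fun a => ⟨Matrix.vecMulVec v a, by
    change Matrix.vecMul z (Matrix.vecMulVec v a) = a
    rw [Matrix.vecMul_vecMulVec, hv, one_smul]⟩
  have := average_comp φ hφ f
  rw [ex_uniform, average]
  refine this.trans ?_
  simp [ZMod.card]

/-- Pairwise independence: H ↦ (zH, z'H) is a surjective homomorphism, with preimage v aᵀ + v' bᵀ of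
(a, b) for v, v' dual to z, z', so its value is a uniform pair. -/
theorem ex_vecMul_mul {z z' : Fin m → ZMod 2} (hz : z ≠ 0) (hz' : z' ≠ 0) (hne : z ≠ z')
    (f : (Fin n → ZMod 2) → ℝ) :
    ex (PMF.uniformOfFintype (Matrix (Fin m) (Fin n) (ZMod 2)))
      (fun H => f (Matrix.vecMul z H) * f (Matrix.vecMul z' H)) = average f ^ 2 := by
  obtain ⟨v, hv, hv0⟩ := exists_dotProduct_eq hz hne
  obtain ⟨v', hv', hv0'⟩ := exists_dotProduct_eq hz' hne.symm
  let φ : Matrix (Fin m) (Fin n) (ZMod 2) →+ (Fin n → ZMod 2) × (Fin n → ZMod 2) :=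
    AddMonoidHom.mk' (fun H => (Matrix.vecMul z H, Matrix.vecMul z' H)) fun A B =>
      Prod.ext (Matrix.vecMul_add A B z) (Matrix.vecMul_add A B z')
  have hφ : Function.Surjective φ := fun ⟨a, b⟩ => ⟨Matrix.vecMulVec v a + Matrix.vecMulVec v' b, by
    change (Matrix.vecMul z _, Matrix.vecMul z' _) = (a, b)
    simp [Matrix.vecMul_add, Matrix.vecMul_vecMulVec, hv, hv', hv0, hv0']⟩
  have := average_comp φ hφ fun q => f q.1 * f q.2
  rw [ex_uniform, average]
  refine this.trans ?_
  rw [Fintype.sum_prod_type, div_pow, sq, Finset.sum_mul_sum]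
  congr 1
  simp [ZMod.card, sq]

/-- The second moment of a sum over the nonzero combinations of the rows of a random matrix. -/
theorem ex_sum_vecMul_sub_sq_le (f : (Fin n → ZMod 2) → ℝ) :
    ex (PMF.uniformOfFintype (Matrix (Fin m) (Fin n) (ZMod 2)))
      (fun H => (∑ z ∈ Finset.univ.erase 0, f (Matrix.vecMul z H) -
        (2 ^ m - 1) * average f) ^ 2) ≤ (2 ^ m - 1) * average fun h => f h ^ 2 := by
  set p := PMF.uniformOfFintype (Matrix (Fin m) (Fin n) (ZMod 2))
  set S := (Finset.univ : Finset (Fin m → ZMod 2)).erase 0 with hS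
  have hcard : (S.card : ℝ) = 2 ^ m - 1 := by
    rw [hS, Finset.card_erase_of_mem (Finset.mem_univ _), Finset.card_univ,
      Nat.cast_sub Fintype.card_pos]
    simp [ZMod.card]
  rw [← hcard]
  have h1 : ∀ H : Matrix (Fin m) (Fin n) (ZMod 2),
      (∑ z ∈ S, f (Matrix.vecMul z H) - S.card * average f) ^ 2 =
      ∑ z ∈ S, ∑ z' ∈ S, (f (Matrix.vecMul z H) - average f) *
        (f (Matrix.vecMul z' H) - average f) := by
    intro H
    rw [← Finset.sum_mul_sum, ← sq, Finset.sum_sub_distrib, Finset.sum_const, nsmul_eq_mul]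
  simp only [h1]
  rw [ex_sum]
  simp only [ex_sum]
  have h2 : ∀ z ∈ S, ∑ z' ∈ S, ex p (fun H => (f (Matrix.vecMul z H) - average f) *
      (f (Matrix.vecMul z' H) - average f)) ≤ average fun h => f h ^ 2 := by
    intro z hz
    have hz0 : z ≠ 0 := Finset.ne_of_mem_erase hz
    -- The covariances off the diagonal vanish by pairwise independence; the diagonal term is a
    -- variance, at most the second moment.
    rw [Finset.sum_eq_single_of_mem z hz]
    · have h3 : ∀ H : Matrix (Fin m) (Fin n) (ZMod 2), (f (Matrix.vecMul z H) - average f) *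
          (f (Matrix.vecMul z H) - average f) = f (Matrix.vecMul z H) ^ 2 -
            2 * average f * f (Matrix.vecMul z H) + average f ^ 2 := fun H => by ring
      simp only [h3]
      rw [ex_add, ex_sub, ex_const_mul, ex_const, ex_vecMul hz0 (fun h => f h ^ 2), ex_vecMul hz0]
      nlinarith [sq_nonneg (average f)]
    · intro z' hz' hne
      have hz0' : z' ≠ 0 := Finset.ne_of_mem_erase hz'
      have h3 : ∀ H : Matrix (Fin m) (Fin n) (ZMod 2), (f (Matrix.vecMul z H) - average f) *
          (f (Matrix.vecMul z' H) - average f) = f (Matrix.vecMul z H) * f (Matrix.vecMul z' H) -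
            average f * f (Matrix.vecMul z H) - average f * f (Matrix.vecMul z' H)
              + average f ^ 2 := fun H => by ring
      simp only [h3]
      rw [ex_add, ex_sub, ex_sub, ex_const_mul, ex_const_mul, ex_const,
        ex_vecMul_mul hz0 hz0' hne.symm, ex_vecMul hz0, ex_vecMul hz0']
      ring
  refine (Finset.sum_le_card_nsmul _ _ _ h2).trans ?_
  rw [nsmul_eq_mul]

end code

/-! ### Krawtchouk polynomials as character sums -/

theorem sum_powerset_sdiff {α : Type*} [Fintype α] [DecidableEq α] (P : Finset α)
    (F : Finset α → ℝ) :
    ∑ S : Finset α, F (S \ P) = 2 ^ P.card * ∑ B ∈ Pᶜ.powerset, F B := by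
  have h : ∑ S : Finset α, F (S \ P) = ∑ q ∈ P.powerset ×ˢ Pᶜ.powerset, F q.2 := by
    refine Finset.sum_nbij' (fun S => (S ∩ P, S \ P)) (fun q => q.1 ∪ q.2) ?_ ?_ ?_ ?_ ?_
    · intro S _
      simp only [Finset.mem_product, Finset.mem_powerset, Finset.inter_subset_right, true_and]
      rw [Finset.sdiff_eq_inter_compl]
      exact Finset.inter_subset_right
    · simp
    · intro S _
      simp only [Finset.union_comm (S ∩ P), Finset.sdiff_union_inter]
    · rintro ⟨A, B⟩ hq
      simp only [Finset.mem_product, Finset.mem_powerset] at hq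
      have hBP : Disjoint B P := Finset.disjoint_of_subset_left hq.2 disjoint_compl_left
      refine Prod.ext ?_ ?_
      · simp only [Finset.union_inter_distrib_right, Finset.inter_eq_left.2 hq.1,
          Finset.disjoint_iff_inter_eq_empty.1 hBP, Finset.union_empty]
      · simp only [Finset.union_sdiff_distrib, Finset.sdiff_eq_empty_iff_subset.2 hq.1,
          Finset.empty_union, Finset.sdiff_eq_self_of_disjoint hBP]
    · intro S _
      rfl
  rw [h]
  simp only [Finset.sum_product, Finset.sum_const, Finset.card_powerset, nsmul_eq_mul]
  push_cast
  rfl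

/-- Sorting the sets `B` by the size j of `B ∩ E` produces the j-th term of the Krawtchouk sum. -/
theorem sum_neg_one_pow_card_inter {α : Type*} [DecidableEq α] {E X : Finset α} (hEX : E ⊆ X)
    (w : ℕ) :
    ∑ B ∈ X.powersetCard w, (-1 : ℝ) ^ (B ∩ E).card = krawtchouk X.card w E.card := by
  have hmaps : ∀ B ∈ X.powersetCard w, (B ∩ E).card ∈ Finset.range (w + 1) := fun B hB => by
    rw [Finset.mem_range, Nat.lt_succ_iff, ← (Finset.mem_powersetCard.1 hB).2]
    exact Finset.card_le_card Finset.inter_subset_left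
  rw [← Finset.sum_fiberwise_of_maps_to hmaps, krawtchouk]
  refine Finset.sum_congr rfl fun j hj => ?_
  rw [Finset.sum_congr rfl fun B hB => by rw [(Finset.mem_filter.1 hB).2], Finset.sum_const,
    card_filter_inter hEX (Nat.lt_succ_iff.1 (Finset.mem_range.1 hj)),
    Finset.card_sdiff_of_subset hEX, nsmul_eq_mul]
  push_cast
  ring

/-- A word and its support. -/
def supportEquiv (n : ℕ) : (Fin n → ZMod 2) ≃ Finset (Fin n) where
  toFun h := Finset.univ.filter fun j => h j ≠ 0
  invFun S := fun j => if j ∈ S then 1 else 0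
  left_inv h := by
    funext j
    rcases zmod_two_cases (h j) with h0 | h0 <;> simp [h0]
  right_inv S := by
    ext j
    simp

/-- Words are identified with their supports. Only the part `B` outside `P` matters, whence the
factor 2^s, and the sign is -1 to the number of errors in `B`. -/
theorem average_signedWeight {n s : ℕ} (w : ℕ) (e : Fin n → ZMod 2) (P : Pos n s) :
    average (signedWeight w e P) = krawtchouk (n - s) w (weightN P e) * 2 ^ s / 2 ^ n := by
  set E := P.1ᶜ.filter fun j => e j ≠ 0 with hE
  have h1 : ∀ h : Fin n → ZMod 2, signedWeight w e P h =
      (fun B => if B.card = w then (-1 : ℝ) ^ (B ∩ E).card else 0) (supportEquiv n h \ P.1) := by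
    intro h
    have hw : weightN P h = (supportEquiv n h \ P.1).card := by
      rw [weightN]
      congr 1
      ext j
      simp [supportEquiv, and_comm]
    have hs : sgn (dotN P e h) = (-1 : ℝ) ^ ((supportEquiv n h \ P.1) ∩ E).card := by
      rw [sgn, dotN, neg_one_pow_val_sum]
      have : (supportEquiv n h \ P.1) ∩ E = P.1ᶜ.filter fun j => e j * h j ≠ 0 := by
        ext j
        simp only [supportEquiv, hE, Equiv.coe_fn_mk, Finset.mem_inter, Finset.mem_sdiff,
          Finset.mem_filter, Finset.mem_univ, true_and, Finset.mem_compl, ne_eq, mul_eq_zero,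
          not_or]
        tauto
      rw [this, ← Finset.prod_const, Finset.prod_filter]
      refine Finset.prod_congr rfl fun j _ => ?_
      rcases zmod_two_cases (e j * h j) with h0 | h0
      · simp [h0]
      · simp [h0, ZMod.val_one]
    simp only [signedWeight, hasWeight, hw, hs]
    split_ifs <;> simp
  rw [average]
  congr 1
  simp only [h1]
  refine (Equiv.sum_comp (supportEquiv n) fun S => (fun B : Finset (Fin n) =>
    if B.card = w then (-1 : ℝ) ^ (B ∩ E).card else 0) (S \ P.1)).trans
    ((sum_powerset_sdiff P.1 fun B : Finset (Fin n) =>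
      if B.card = w then (-1 : ℝ) ^ (B ∩ E).card else 0).trans ?_)
  rw [P.2, ← Finset.sum_filter, ← Finset.powersetCard_eq_filter,
    sum_neg_one_pow_card_inter (Finset.filter_subset _ _), Finset.card_compl, P.2, Fintype.card_fin,
    mul_comm]
  rfl

theorem krawtchouk_zero (n w : ℕ) : krawtchouk n w 0 = n.choose w := by
  rw [krawtchouk, Finset.sum_eq_single 0]
  · simp
  · intro j _ hj
    obtain ⟨i, rfl⟩ := Nat.exists_eq_succ_of_ne_zero hj
    simp
  · simp

theorem average_hasWeight {n s : ℕ} (w : ℕ) (P : Pos n s) :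
    average (hasWeight w P) = (n - s).choose w * 2 ^ s / 2 ^ n := by
  have h := average_signedWeight w 0 P
  have h0 : weightN P (0 : Fin n → ZMod 2) = 0 := by simp [weightN]
  have h1 : signedWeight w 0 P = hasWeight w P := by
    funext h
    simp [signedWeight, dotN, sgn_zero]
  rwa [h0, h1, krawtchouk_zero] at h

/-! ### The bias of the samples for a random code -/

theorem hasWeight_sq {n s : ℕ} (w : ℕ) (P : Pos n s) (h : Fin n → ZMod 2) :
    hasWeight w P h ^ 2 = hasWeight w P h := by
  unfold hasWeight
  split_ifs <;> norm_num

theorem signedWeight_sq {n s : ℕ} (w : ℕ) (e : Fin n → ZMod 2) (P : Pos n s)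
    (h : Fin n → ZMod 2) : signedWeight w e P h ^ 2 = hasWeight w P h := by
  rw [signedWeight, mul_pow, hasWeight_sq, sq, sgn_mul_self, mul_one]

/-- For w = 0 the estimated bias is 1. Thus the zero word, the only combination zH that is not
random, never counts as a check. -/
theorem ne_zero_of_abs_estBias_lt_one {n s u w : ℕ} (h : |estBias n s u w| < 1) : w ≠ 0 := by
  rintro rfl
  simp [estBias, krawtchouk] at h

/-- Relative errors below 1/10 leave at least 9/11 of δ², and 9/11 > 3/4. -/
theorem le_mul_div_of_close {δ μ A B : ℝ} (hμ : 0 < μ) (hA : (A - μ) ^ 2 < (μ / 10) ^ 2)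
    (hB : (B - δ * μ) ^ 2 < (δ * μ / 10) ^ 2) : 3 / 4 * δ ^ 2 ≤ δ * (B / A) := by
  obtain ⟨h1, h2⟩ := abs_lt.1 (abs_lt_of_sq_lt_sq hA (by positivity))
  have hA0 : 0 < A := by linarith
  have h3 : (δ * B - δ ^ 2 * μ) ^ 2 ≤ (δ ^ 2 * μ / 10) ^ 2 := by
    have := mul_le_mul_of_nonneg_left hB.le (sq_nonneg δ)
    nlinarith
  have h4 := (abs_le.1 (abs_le_of_sq_le_sq h3 (by positivity))).1
  rw [mul_div_assoc', le_div_iff₀ hA0]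
  nlinarith [sq_nonneg δ, mul_nonneg (sq_nonneg δ) hμ.le]

open Classical in
-- Chebyshev's inequality for numerator and denominator, both of variance at most μ because the
-- squares of `signedWeight` and `hasWeight` coincide: 100/μ + 100/(δ²μ), and δ² ≤ 1.
theorem ex_bad_bias_le {n s m w : ℕ} (e : Fin n → ZMod 2) (P : Pos n s) {δ μ : ℝ}
    (hδ : estBias n s (weightN P e) w = δ) (hδ0 : δ ≠ 0) (hδ1 : |δ| < 1) (hμ0 : 0 < μ)
    (hμ : (2 ^ m - 1) * ((n - s).choose w * 2 ^ s / 2 ^ n) = μ) :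
    ex (PMF.uniformOfFintype (Matrix (Fin m) (Fin n) (ZMod 2)))
      (fun H => if 3 / 4 * δ ^ 2 ≤ δ * lpnBias (code H) w e P then (0 : ℝ) else 1) ≤
      200 / (δ ^ 2 * μ) := by
  have hw : w ≠ 0 := ne_zero_of_abs_estBias_lt_one (by rw [hδ]; exact hδ1)
  set p := PMF.uniformOfFintype (Matrix (Fin m) (Fin n) (ZMod 2))
  have hw0 : hasWeight w P (0 : Fin n → ZMod 2) = 0 := by
    rw [hasWeight, if_neg]
    simpa [weightN] using hw.symm
  have hw0' : signedWeight w e P (0 : Fin n → ZMod 2) = 0 := by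
    rw [signedWeight, hw0, zero_mul]
  have hC : ((n - s).choose w : ℝ) ≠ 0 := by
    intro h
    rw [estBias, h, div_zero] at hδ
    exact hδ0 hδ.symm
  have hK : krawtchouk (n - s) w (weightN P e) = δ * (n - s).choose w := by
    rw [← hδ, estBias, div_mul_cancel₀ _ hC]
  have mA := ex_sum_vecMul_sub_sq_le (m := m) (hasWeight w P)
  have mB := ex_sum_vecMul_sub_sq_le (m := m) (signedWeight w e P)
  have eA : (2 ^ m - 1) * average (hasWeight w P) = μ := by rw [average_hasWeight, hμ]
  have eB : (2 ^ m - 1) * average (signedWeight w e P) = δ * μ := by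
    rw [average_signedWeight, hK, ← hμ]
    ring
  simp only [hasWeight_sq, signedWeight_sq] at mA mB
  have eA' : (2 ^ m - 1) * (average fun h => hasWeight w P h) = μ := eA
  rw [eA'] at mA
  rw [eA', eB] at mB
  have key : ∀ H : Matrix (Fin m) (Fin n) (ZMod 2),
      (if 3 / 4 * δ ^ 2 ≤ δ * lpnBias (code H) w e P then (0 : ℝ) else 1) ≤
      100 / μ ^ 2 * (∑ z ∈ Finset.univ.erase 0, hasWeight w P (Matrix.vecMul z H) - μ) ^ 2 +
      100 / (δ * μ) ^ 2 *
        (∑ z ∈ Finset.univ.erase 0, signedWeight w e P (Matrix.vecMul z H) - δ * μ) ^ 2 := by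
    intro H
    have sA : ∑ z ∈ Finset.univ.erase 0, hasWeight w P (Matrix.vecMul z H) =
        ∑ z, hasWeight w P (Matrix.vecMul z H) :=
      Finset.sum_erase _ (by rw [Matrix.zero_vecMul, hw0])
    have sB : ∑ z ∈ Finset.univ.erase 0, signedWeight w e P (Matrix.vecMul z H) =
        ∑ z, signedWeight w e P (Matrix.vecMul z H) :=
      Finset.sum_erase _ (by rw [Matrix.zero_vecMul, hw0'])
    rw [lpnBias_code, ← sA, ← sB]
    set A := ∑ z ∈ Finset.univ.erase 0, hasWeight w P (Matrix.vecMul z H)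
    set B := ∑ z ∈ Finset.univ.erase 0, signedWeight w e P (Matrix.vecMul z H)
    split_ifs with h
    · positivity
    · by_cases hA : (A - μ) ^ 2 < (μ / 10) ^ 2
      · by_cases hB : (B - δ * μ) ^ 2 < (δ * μ / 10) ^ 2
        · exact absurd (le_mul_div_of_close hμ0 hA hB) h
        · have h1 : 1 ≤ 100 / (δ * μ) ^ 2 * (B - δ * μ) ^ 2 := by
            rw [div_mul_eq_mul_div, le_div_iff₀ (by positivity)]
            linarith [not_lt.1 hB]
          have h2 : 0 ≤ 100 / μ ^ 2 * (A - μ) ^ 2 := by positivity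
          linarith
      · have h1 : 1 ≤ 100 / μ ^ 2 * (A - μ) ^ 2 := by
          rw [div_mul_eq_mul_div, le_div_iff₀ (by positivity)]
          linarith [not_lt.1 hA]
        have h2 : 0 ≤ 100 / (δ * μ) ^ 2 * (B - δ * μ) ^ 2 := by positivity
        linarith
  refine (ex_mono p key).trans ?_
  rw [ex_add, ex_const_mul, ex_const_mul]
  have h1 : 100 / μ ^ 2 * μ + 100 / (δ * μ) ^ 2 * μ = 100 * (δ ^ 2 + 1) / (δ ^ 2 * μ) := by
    field_simp
  have h2 : δ ^ 2 ≤ 1 := (sq_le_one_iff_abs_le_one δ).2 hδ1.le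
  calc _ ≤ 100 / μ ^ 2 * μ + 100 / (δ * μ) ^ 2 * μ := by gcongr
    _ = 100 * (δ ^ 2 + 1) / (δ ^ 2 * μ) := h1
    _ ≤ 200 / (δ ^ 2 * μ) := by
        gcongr
        linarith

/-! ### Success of the decoder -/

theorem ex_uniformPos {n s : ℕ} (hs : s ≤ n) (f : Pos n s → ℝ) :
    ex (uniformPos hs) f = (∑ P, f P) / n.choose s := by
  have := nonempty_pos hs
  rw [uniformPos, ex_uniform, card_pos]

theorem ex_iteration {n s : ℕ} (hs : s ≤ n) (N w : ℕ) (e : Fin n → ZMod 2)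
    (C : Set (Fin n → ZMod 2)) (f : Pos n s × (Fin N → Sample s) → ℝ) :
    ex (iteration hs N w e C) f = ex (uniformPos hs) fun P =>
      ex (iid (lpnOracle (onP P e) (lpnBias C w e P) (abs_bias_le_one _ _)) N)
        fun smp => f (P, smp) := by
  simp only [iteration, ex_bind, ex_map]

theorem two_pow_mul_exp_le {n s N : ℕ} (hs : s ≤ n) {δ : ℝ} (hX : 128 * (n : ℝ) ≤ N * δ ^ 2) :
    (2 : ℝ) ^ s * Real.exp (-(N * δ ^ 2 / 8)) ≤ Real.exp (-(15 * n)) := by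
  have h1 : (2 : ℝ) ≤ Real.exp 1 := by linarith [Real.add_one_le_exp (1 : ℝ)]
  have h2 : (2 : ℝ) ^ s ≤ Real.exp n := by
    calc (2 : ℝ) ^ s ≤ 2 ^ n := pow_le_pow_right₀ (by norm_num) hs
      _ ≤ Real.exp 1 ^ n := pow_le_pow_left₀ (by norm_num) h1 n
      _ = Real.exp n := by rw [← Real.exp_nat_mul, mul_one]
  calc (2 : ℝ) ^ s * Real.exp (-(N * δ ^ 2 / 8)) ≤ Real.exp n * Real.exp (-(16 * n)) := by
        gcongr
        linarith
    _ = Real.exp (-(15 * n)) := by rw [← Real.exp_add]; congr 1; ring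

theorem exp_neg_le_quarter {x : ℝ} (hx : 2 ≤ x) : Real.exp (-x) ≤ 1 / 4 := by
  have h1 : (2 : ℝ) ≤ Real.exp 1 := by linarith [Real.add_one_le_exp (1 : ℝ)]
  have h2 : (4 : ℝ) ≤ Real.exp x := by
    calc (4 : ℝ) ≤ Real.exp 1 * Real.exp 1 := by nlinarith
      _ = Real.exp 2 := by rw [← Real.exp_add]; norm_num
      _ ≤ Real.exp x := Real.exp_le_exp.2 hx
  rw [Real.exp_neg, one_div]
  exact inv_anti₀ (by norm_num) h2

open Classical in
-- If `x` alone reaches the threshold, it is the maximizer. Each of the two ways to fail has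
-- probability at most 1/4.
theorem half_le_ex_solveVal {n s N : ℕ} (hs : s ≤ n) (hn : 1 ≤ n) (x : Word s) {δ ε : ℝ}
    (hδ : |δ| < 1) (hδ0 : δ ≠ 0) (hX : 128 * (n : ℝ) ≤ N * δ ^ 2) (hε : |ε| ≤ 1)
    (hεδ : 3 / 4 * δ ^ 2 ≤ δ * ε) :
    1 / 2 ≤ ex (iid (lpnOracle x ε hε) N)
      (fun smp => if solveVal δ smp = some x then (1 : ℝ) else 0) := by
  have hn' : (1 : ℝ) ≤ n := by exact_mod_cast hn
  have h1 := (ex_solveVal_wrong_le x hδ hδ0 hε N).trans (two_pow_mul_exp_le hs hX)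
  have h2 := ex_true_fail_le x hδ hε hεδ N
  have h3 := exp_neg_le_quarter (x := 15 * n) (by linarith)
  have h4 := exp_neg_le_quarter (x := N * δ ^ 2 / 64) (by linarith)
  have key : ∀ smp : Fin N → Sample s,
      1 - (if ∃ y ≠ x, threshold δ N ≤ fourier (llr δ smp) y then (1 : ℝ) else 0) -
      (if δ ^ 2 * N / 2 ≤ δ * ∑ i, agreement x (smp i) then (0 : ℝ) else 1) ≤
      if solveVal δ smp = some x then (1 : ℝ) else 0 := by
    intro smp
    by_cases ha : ∃ y ≠ x, threshold δ N ≤ fourier (llr δ smp) y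
    · rw [if_pos ha]
      split_ifs <;> norm_num
    · by_cases hb : δ ^ 2 * N / 2 ≤ δ * ∑ i, agreement x (smp i)
      · rw [if_pos (solveVal_eq_some ((threshold_le_iff hδ hδ0 smp x).2 hb) ha), if_neg ha,
          if_pos hb]
        norm_num
      · rw [if_neg ha, if_neg hb]
        split_ifs <;> norm_num
  have h5 := ex_mono (iid (lpnOracle x ε hε) N) key
  rw [ex_sub, ex_sub, ex_const] at h5
  linarith

open Classical in
theorem ex_wrong_iteration_le {n s N w : ℕ} (hs : s ≤ n) (e : Fin n → ZMod 2)
    (C : Set (Fin n → ZMod 2)) {δ : ℝ} (hδ : |δ| < 1) (hδ0 : δ ≠ 0)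
    (hX : 128 * (n : ℝ) ≤ N * δ ^ 2) :
    ex (iteration hs N w e C)
      (fun q => if ∃ x ≠ onP q.1 e, solveVal δ q.2 = some x then 1 else 0) ≤
      Real.exp (-(15 * n)) := by
  rw [ex_iteration, ← ex_const (uniformPos hs) (Real.exp (-(15 * n)))]
  refine ex_mono _ fun P => le_trans (ex_mono _ fun smp => ?_)
    ((ex_solveVal_wrong_le (onP P e) hδ hδ0 (abs_bias_le_one _ _) N).trans
      (two_pow_mul_exp_le hs hX))
  split_ifs with h1 h2 h2
  · exact le_rfl
  · exfalso
    obtain ⟨x, hx, hx'⟩ := h1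
    exact h2 ⟨x, hx, le_of_solveVal_eq_some hx'⟩
  · norm_num
  · exact le_rfl

open Classical in
-- At least half of the sets with `u` errors outside have a good bias, and on each of them the
-- iteration succeeds with probability at least 1/2.
theorem le_ex_right_iteration {n s N w u : ℕ} (hs : s ≤ n) (hn : 1 ≤ n) (e : Fin n → ZMod 2)
    (C : Set (Fin n → ZMod 2)) {δ p : ℝ} (hδ : |δ| < 1) (hδ0 : δ ≠ 0)
    (hX : 128 * (n : ℝ) ≤ N * δ ^ 2)
    (hR : ((Finset.univ.filter fun P : Pos n s => weightN P e = u).card : ℝ) = p * n.choose s)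
    (hgood : 2 * (∑ P with weightN P e = u,
      if 3 / 4 * δ ^ 2 ≤ δ * lpnBias C w e (P : Pos n s) then (0 : ℝ) else 1) ≤ p * n.choose s) :
    p / 4 ≤ ex (iteration hs N w e C)
      (fun q => if solveVal δ q.2 = some (onP q.1 e) then 1 else 0) := by
  have hpos : (0 : ℝ) < n.choose s := Nat.cast_pos.2 (Nat.choose_pos hs)
  rw [ex_iteration, ex_uniformPos, le_div_iff₀ hpos]
  have h1 : ∑ P with weightN P e = u, (1 / 2 - 1 / 2 *
      if 3 / 4 * δ ^ 2 ≤ δ * lpnBias C w e (P : Pos n s) then (0 : ℝ) else 1) ≤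
      ∑ P with weightN P e = u, ex (iid (lpnOracle (onP P e) (lpnBias C w e (P : Pos n s))
        (abs_bias_le_one _ _)) N)
        (fun smp => if solveVal δ smp = some (onP P e) then 1 else 0) := by
    refine Finset.sum_le_sum fun P _ => ?_
    split_ifs with h
    · have := half_le_ex_solveVal hs hn (onP P e) hδ hδ0 hX (abs_bias_le_one _ _) h
      rw [mul_zero, sub_zero]
      exact this
    · rw [mul_one, sub_self]
      exact ex_nonneg _ fun smp => by split_ifs <;> norm_num
  have h2 := Finset.sum_le_sum_of_subset_of_nonneg
    (f := fun P : Pos n s => ex (iid (lpnOracle (onP P e) (lpnBias C w e P)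
        (abs_bias_le_one _ _)) N)
        (fun smp => if solveVal δ smp = some (onP P e) then (1 : ℝ) else 0))
    (Finset.filter_subset (fun P : Pos n s => weightN P e = u) Finset.univ)
    (fun P _ _ => ex_nonneg _ fun smp => by split_ifs <;> norm_num)
  rw [Finset.sum_sub_distrib, Finset.sum_const, nsmul_eq_mul, ← Finset.mul_sum, hR] at h1
  linarith

/-- The numerator of P_succ is a positive integer and its denominator is at most 2^n. Hence
exp(-15n) beats the waiting time for a good set. -/
theorem one_div_pSucc_le {n s t u : ℕ} (hp : 0 < pSucc n s t u) :
    1 / pSucc n s t u ≤ Real.exp n := by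
  have h1 : (2 : ℝ) ≤ Real.exp 1 := by linarith [Real.add_one_le_exp (1 : ℝ)]
  have hnum : (1 : ℝ) ≤ (s.choose (t - u) : ℝ) * ((n - s).choose u : ℝ) := by
    have : s.choose (t - u) * (n - s).choose u ≠ 0 := by
      intro h
      rw [pSucc, ← Nat.cast_mul, h] at hp
      simp at hp
    exact_mod_cast Nat.one_le_iff_ne_zero.2 this
  have hc : (n.choose t : ℝ) ≤ 2 ^ n := by exact_mod_cast Nat.choose_le_two_pow n t
  rw [pSucc, one_div_div]
  calc (n.choose t : ℝ) / (s.choose (t - u) * (n - s).choose u) ≤ n.choose t :=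
        div_le_self (Nat.cast_nonneg _) hnum
    _ ≤ 2 ^ n := hc
    _ ≤ Real.exp 1 ^ n := pow_le_pow_left₀ (by norm_num) h1 n
    _ = Real.exp n := by rw [← Real.exp_nat_mul, mul_one]

open Classical in
theorem fail_le_of_good {n s N w t u : ℕ} (hs : s ≤ n) (hn : 1 ≤ n) (hut : u ≤ t)
    (hun : u ≤ n - s) {e : Fin n → ZMod 2} (he : hammingNorm e = t)
    (C : Set (Fin n → ZMod 2)) {δ : ℝ} (hδ : |δ| < 1) (hδ0 : δ ≠ 0)
    (hX : 128 * (n : ℝ) ≤ N * δ ^ 2) (hp : 0 < pSucc n s t u)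
    (hgood : 2 * (∑ P with weightN P e = u,
      if 3 / 4 * δ ^ 2 ≤ δ * lpnBias C w e (P : Pos n s) then (0 : ℝ) else 1) ≤
        pSucc n s t u * n.choose s) (Niter : ℕ) :
    ex (iid (iteration hs N w e C) Niter)
      (fun it => if IsCorrect e (decoderVal δ (List.ofFn it)) then (0 : ℝ) else 1) ≤
      Real.exp (-(Niter * pSucc n s t u / 4)) + 4 * Real.exp (-n) := by
  set p := pSucc n s t u with hpdef
  have hp1 : p ≤ 1 := pSucc_le_one hs hut hun he
  have h := decoderVal_fail_le δ e (iteration hs N w e C) (g := p / 4) (by linarith)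
    (le_ex_right_iteration hs hn e C hδ hδ0 hX (card_weightN_eq hs hut hun he) hgood)
    (ex_wrong_iteration_le hs e C hδ hδ0 hX) Niter
  refine h.trans (add_le_add ?_ ?_)
  · calc (1 - p / 4) ^ Niter ≤ Real.exp (-(p / 4)) ^ Niter := by
          refine pow_le_pow_left₀ (by linarith) ?_ _
          linarith [Real.add_one_le_exp (-(p / 4))]
      _ = Real.exp (-(Niter * p / 4)) := by
          rw [← Real.exp_nat_mul]
          congr 1
          ring
  · calc Real.exp (-(15 * n)) / (p / 4) = 4 * (Real.exp (-(15 * n)) * (1 / p)) := by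
          field_simp
      _ ≤ 4 * (Real.exp (-(15 * n)) * Real.exp n) := by
          gcongr
          exact one_div_pSucc_le hp
      _ ≤ 4 * Real.exp (-n) := by
          rw [← Real.exp_add]
          gcongr
          linarith [Nat.cast_nonneg (α := ℝ) n]

/-- Leaving out z = 0 costs at most a factor 2 when k < n. If k = n, the bound on `N` would give N ≤
1. -/
theorem mean_checks_ge {n k s w N : ℕ} (hk : k ≤ n) (hs : s ≤ n) (hN1 : (1 : ℝ) < N)
    (hN : (N : ℝ) ≤ ((n - s).choose w : ℝ) / (2 : ℝ) ^ ((k : ℤ) - (s : ℤ))) :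
    (N : ℝ) / 2 ≤ (2 ^ (n - k) - 1) * ((n - s).choose w * 2 ^ s / 2 ^ n) := by
  have h2 : (2 : ℝ) ^ ((k : ℤ) - (s : ℤ)) = 2 ^ k / 2 ^ s := by
    rw [zpow_sub₀ (by norm_num), zpow_natCast, zpow_natCast]
  rw [h2, div_div_eq_mul_div] at hN
  have hkn : k ≠ n := by
    rintro rfl
    have hc : ((k - s).choose w : ℝ) ≤ 2 ^ (k - s) := by
      exact_mod_cast Nat.choose_le_two_pow _ _
    have : ((k - s).choose w : ℝ) * 2 ^ s / 2 ^ k ≤ 1 := by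
      rw [div_le_one (by positivity)]
      calc ((k - s).choose w : ℝ) * 2 ^ s ≤ 2 ^ (k - s) * 2 ^ s := by gcongr
        _ = 2 ^ k := by rw [← pow_add, Nat.sub_add_cancel hs]
    linarith
  have h3 : (2 : ℝ) ^ n = 2 ^ (n - k) * 2 ^ k := by rw [← pow_add, Nat.sub_add_cancel hk]
  have h4 : (2 : ℝ) ≤ 2 ^ (n - k) := by
    calc (2 : ℝ) = 2 ^ 1 := (pow_one 2).symm
      _ ≤ 2 ^ (n - k) := pow_le_pow_right₀ (by norm_num) (by omega)
  calc (N : ℝ) / 2 ≤ ((n - s).choose w * 2 ^ s / 2 ^ k) / 2 := by linarith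
    _ = 2 ^ (n - k) / 2 * ((n - s).choose w * 2 ^ s / 2 ^ n) := by
        rw [h3]
        field_simp
    _ ≤ _ := by
        gcongr
        linarith

open Classical in
-- A code for which more than half of the `c` relevant sets are bad is counted as a failure, which
-- (2/c)·bad dominates. The mean of `bad` is computed set by set, so no independence between sets is
-- needed.
theorem experiment_fail_le {n k s N w t u : ℕ} (hk : k ≤ n) (hs : s ≤ n) (hn : 1 ≤ n)
    (hut : u ≤ t) (hun : u ≤ n - s) {e : Fin n → ZMod 2} (he : hammingNorm e = t)
    {δ : ℝ} (hδe : estBias n s u w = δ) (hδ : |δ| < 1) (hδ0 : δ ≠ 0)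
    (hN : (N : ℝ) ≤ ((n - s).choose w : ℝ) / (2 : ℝ) ^ ((k : ℤ) - (s : ℤ)))
    (hX : 128 * (n : ℝ) ≤ N * δ ^ 2) (hp : 0 < pSucc n s t u) (Niter : ℕ) :
    ex (experiment hs k N w Niter e)
      (fun it => if IsCorrect e (decoderVal δ (List.ofFn it)) then (0 : ℝ) else 1) ≤
      800 / (N * δ ^ 2) + (Real.exp (-(Niter * pSucc n s t u / 4)) + 4 * Real.exp (-n)) := by
  have hδ2 : δ ^ 2 ≤ 1 := (sq_le_one_iff_abs_le_one δ).2 hδ.le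
  have hn' : (1 : ℝ) ≤ n := by exact_mod_cast hn
  have hN1 : (1 : ℝ) < N := by
    have : (N : ℝ) * δ ^ 2 ≤ N := mul_le_of_le_one_right (Nat.cast_nonneg N) hδ2
    linarith
  set μ : ℝ := (2 ^ (n - k) - 1) * ((n - s).choose w * 2 ^ s / 2 ^ n) with hμ
  have hμN : (N : ℝ) / 2 ≤ μ := mean_checks_ge hk hs hN1 hN
  have hμ0 : 0 < μ := by linarith
  have hpos : (0 : ℝ) < n.choose s := Nat.cast_pos.2 (Nat.choose_pos hs)
  set c := pSucc n s t u * n.choose s with hc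
  have hc0 : 0 < c := by positivity
  set F := Real.exp (-(Niter * pSucc n s t u / 4)) + 4 * Real.exp (-n) with hF
  have hF0 : 0 ≤ F := by positivity
  rw [experiment, ex_bind]
  set bad : Matrix (Fin (n - k)) (Fin n) (ZMod 2) → ℝ := fun H => ∑ P with weightN P e = u,
    if 3 / 4 * δ ^ 2 ≤ δ * lpnBias (code H) w e (P : Pos n s) then (0 : ℝ) else 1 with hbad
  have hbad0 : ∀ H, 0 ≤ bad H := fun H =>
    Finset.sum_nonneg fun P _ => by split_ifs <;> norm_num
  have key : ∀ H : Matrix (Fin (n - k)) (Fin n) (ZMod 2),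
      ex (iid (iteration hs N w e (code H)) Niter)
      (fun it => if IsCorrect e (decoderVal δ (List.ofFn it)) then (0 : ℝ) else 1) ≤
      2 / c * bad H + F := by
    intro H
    by_cases h : 2 * bad H ≤ c
    · have := fail_le_of_good hs hn hut hun he (code H) hδ hδ0 hX hp h Niter
      have h2 : 0 ≤ 2 / c * bad H := mul_nonneg (by positivity) (hbad0 H)
      linarith
    · have h1 := ex_mono (iid (iteration hs N w e (code H)) Niter) (f := fun it =>
        if IsCorrect e (decoderVal δ (List.ofFn it)) then (0 : ℝ) else 1) (g := fun _ => 1)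
        fun it => by split_ifs <;> norm_num
      rw [ex_const] at h1
      have h2 : 1 ≤ 2 / c * bad H := by
        rw [div_mul_eq_mul_div, le_div_iff₀ hc0]
        linarith
      linarith
  refine (ex_mono _ key).trans ?_
  rw [ex_add, ex_const, ex_const_mul, ex_sum]
  have h1 := Finset.sum_le_card_nsmul (Finset.univ.filter fun P : Pos n s => weightN P e = u)
    (fun P => ex (PMF.uniformOfFintype (Matrix (Fin (n - k)) (Fin n) (ZMod 2)))
      (fun H => if 3 / 4 * δ ^ 2 ≤ δ * lpnBias (code H) w e P then (0 : ℝ) else 1))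
    (200 / (δ ^ 2 * μ)) fun P hP => ex_bad_bias_le e P
      (by rw [(Finset.mem_filter.1 hP).2]; exact hδe) hδ0 hδ hμ0 hμ.symm
  rw [nsmul_eq_mul, card_weightN_eq hs hut hun he] at h1
  have h2 : 200 / (δ ^ 2 * μ) ≤ 400 / (N * δ ^ 2) := by
    rw [div_le_div_iff₀ (by positivity) (by nlinarith)]
    nlinarith [mul_le_mul_of_nonneg_left hμN (sq_nonneg δ)]
  refine add_le_add ?_ le_rfl
  calc _ ≤ 2 / c * (c * (200 / (δ ^ 2 * μ))) := mul_le_mul_of_nonneg_left h1 (by positivity)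
    _ = 2 * (200 / (δ ^ 2 * μ)) := by field_simp
    _ ≤ 2 * (400 / (N * δ ^ 2)) := by linarith
    _ = 800 / (N * δ ^ 2) := by ring

theorem toOuterMeasure_compl_le {α : Type} [Fintype α] (p : PMF α) {Q : α → Prop}
    [DecidablePred Q] {r : ℝ} (h : ex p (fun x => if Q x then (0 : ℝ) else 1) ≤ r) :
    ENNReal.ofReal (1 - r) ≤ p.toOuterMeasure {x | Q x} := by
  classical
  rw [toOuterMeasure_eq_ex]
  refine ENNReal.ofReal_le_ofReal ?_
  refine le_trans ?_ (ex_mono p (f := fun x => 1 - if Q x then (0 : ℝ) else 1) fun x => ?_)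
  · rw [ex_sub, ex_const]
    linarith
  · by_cases hx : Q x <;> simp [hx]

theorem tendsto_success {k s t u w N Niter : ℕ → ℕ} (hk : ∀ n, k n ≤ n) (hs : ∀ n, s n ≤ n)
    (hut : ∀ n, u n ≤ t n) (hun : ∀ n, u n ≤ n - s n)
    (e : ∀ n, Fin n → ZMod 2) (he : ∀ n, hammingNorm (e n) = t n)
    (hδ : ∀ᶠ n in Filter.atTop, |estBias n (s n) (u n) (w n)| < 1)
    (hN : ∀ᶠ n in Filter.atTop,
      (N n : ℝ) ≤ ((n - s n).choose (w n) : ℝ) / (2 : ℝ) ^ ((k n : ℤ) - (s n : ℤ)))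
    (hX : IsOmega (fun n => (N n : ℝ)) (fun n => (n : ℝ) *
      (((n - s n).choose (w n) : ℝ) / krawtchouk (n - s n) (w n) (u n)) ^ 2))
    (hY : IsOmega (fun n => (Niter n : ℝ)) (fun n => 1 / pSucc n (s n) (t n) (u n)))
    (M : ∀ n, Mem (s n)) :
    Filter.Tendsto (fun n =>
      (experiment (hs n) (k n) (N n) (w n) (Niter n) (e n)).toOuterMeasure
        {it | IsCorrect (e n) ((rlpnOn (estBias n (s n) (u n) (w n)) it).run (M n)).1})
      Filter.atTop (nhds 1) := by
  classical
  set X : ℕ → ℝ := fun n => (N n : ℝ) * estBias n (s n) (u n) (w n) ^ 2 / n with hXdef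
  -- The identity also holds where K or n is 0: division by zero makes both sides 0. So the growth
  -- hypothesis itself gives δ ≠ 0 for large n, and likewise `hY'` gives P_succ > 0.
  have hX' : Filter.Tendsto X Filter.atTop Filter.atTop := by
    refine hX.congr fun n => ?_
    rw [hXdef, Nat.abs_cast]
    simp only [estBias]
    rw [← inv_div (krawtchouk (n - s n) (w n) (u n)), inv_pow, ← div_eq_mul_inv, div_div_eq_mul_div]
  have hY' : Filter.Tendsto (fun n => (Niter n : ℝ) * pSucc n (s n) (t n) (u n))
      Filter.atTop Filter.atTop := by
    refine hY.congr fun n => ?_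
    simp only [Nat.abs_cast, one_div, div_inv_eq_mul]
  set r : ℕ → ℝ := fun n => 800 / X n +
    (Real.exp (-(Niter n * pSucc n (s n) (t n) (u n) / 4)) + 4 * Real.exp (-n)) with hr
  have hr0 : Filter.Tendsto r Filter.atTop (nhds 0) := by
    have h1 : Filter.Tendsto (fun n => 800 / X n) Filter.atTop (nhds 0) :=
      Filter.Tendsto.const_div_atTop hX' 800
    have h2 : Filter.Tendsto (fun n => Real.exp (-(Niter n * pSucc n (s n) (t n) (u n) / 4)))
        Filter.atTop (nhds 0) :=
      Real.tendsto_exp_neg_atTop_nhds_zero.comp (hY'.atTop_div_const (by norm_num))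
    have h3 : Filter.Tendsto (fun n : ℕ => 4 * Real.exp (-(n : ℝ))) Filter.atTop (nhds 0) := by
      have := (Real.tendsto_exp_neg_atTop_nhds_zero.comp
        (tendsto_natCast_atTop_atTop (R := ℝ))).const_mul 4
      rwa [mul_zero] at this
    have := h1.add (h2.add h3)
    rwa [add_zero, add_zero] at this
  have hlow : Filter.Tendsto (fun n => ENNReal.ofReal (1 - r n)) Filter.atTop (nhds 1) := by
    have := ENNReal.tendsto_ofReal (hr0.const_sub 1)
    rwa [sub_zero, ENNReal.ofReal_one] at this
  refine tendsto_of_tendsto_of_tendsto_of_le_of_le' hlow tendsto_const_nhds ?_ ?_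
  · filter_upwards [hδ, hN, hX'.eventually_ge_atTop 128, hY'.eventually_gt_atTop 0,
      Filter.eventually_ge_atTop 1] with n hδ hN hX hY hn
    have hn' : (1 : ℝ) ≤ n := by exact_mod_cast hn
    have hX2 : 128 * (n : ℝ) ≤ N n * estBias n (s n) (u n) (w n) ^ 2 := by
      rw [hXdef] at hX
      simp only at hX
      rwa [le_div_iff₀ (by linarith)] at hX
    have hδ0 : estBias n (s n) (u n) (w n) ≠ 0 := by
      intro h
      rw [h, zero_pow two_ne_zero, mul_zero] at hX2
      linarith
    have hp : 0 < pSucc n (s n) (t n) (u n) := pos_of_mul_pos_right hY (Nat.cast_nonneg _)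
    have h := experiment_fail_le (hk n) (hs n) hn (hut n) (hun n) (he n) rfl hδ hδ0 hN hX2 hp
      (Niter n)
    simp only [run_rlpnOn]
    refine toOuterMeasure_compl_le _ (h.trans ?_)
    rw [hr]
    refine add_le_add ?_ le_rfl
    have hX0 : 0 < X n := by linarith
    refine div_le_div_of_nonneg_left (by norm_num) hX0 ?_
    rw [hXdef]
    exact div_le_self (by positivity) hn'
  · refine Filter.Eventually.of_forall fun n => ?_
    rw [toOuterMeasure_eq_ex, ENNReal.ofReal_le_one]
    exact (ex_mono _ (g := fun _ => 1) fun it => by split_ifs <;> norm_num).trans (ex_const _ 1).le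

end

end RLPN

/-! ### Law of the errors, semantics, cost and success probability of the decoder -/

open RLPN in
theorem mainTheorem3
    (k s t u w N Niter : ℕ → ℕ)
    (hk : ∀ n, k n ≤ n) (hs : ∀ n, s n ≤ n) (hut : ∀ n, u n ≤ t n) (hun : ∀ n, u n ≤ n - s n)
    (e : ∀ n, Fin n → ZMod 2) (he : ∀ n, hammingNorm (e n) = t n) :
    -- the probability that there are exactly `u` errors outside a random set of `s` positions
    (∀ n, (uniformPos (hs n)).toOuterMeasure {P | weightN P (e n) = u n} =
      ENNReal.ofReal (pSucc n (s n) (t n) (u n))) ∧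
    -- on any samples, an iteration maximizes the Fourier transform of the log-likelihood function
    (∀ (n : ℕ) (δ : ℝ) (smp : Fin (N n) → Sample (s n)) (M : Mem (s n)),
      IterSpec δ smp ((load smp >>= fun _ => solve (s n) (N n) δ).run M).1) ∧
    -- the samples which the decoder works on are LPN samples with secret `e_𝒫`
    (∀ (n Seq Teq : ℕ) (δ : ℝ) (H : Matrix (Fin (n - k n)) (Fin n) (ZMod 2)) (c : Fin n → ZMod 2)
      (P : Fin (Niter n) → Pos n (s n)) (create : Fin (Niter n) → Prog (s n) Unit)
      (W : Finset (Cell (s n))) (M : Mem (s n)),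
      IsExecution (k n) (N n) (w n) Seq Teq (e n) H c P create W M →
      ∃ h : Fin (Niter n) → Fin (N n) → Fin n → ZMod 2,
        (∀ j, AreChecks (code H) (w n) (P j) (h j)) ∧
        ((rlpn (N n) δ P create).run M).1 =
          ((rlpnOn δ fun j => (P j, lpnSamples (onP (P j) (e n)) (fun i => onP (P j) (h j i))
            fun i => dotN (P j) (e n) (h j i))).run M).1) ∧
    -- space and time
    (∀ Seq Teq : ℕ → ℕ,
      (∃ K : ℝ, ∀ (n : ℕ) (δ : ℝ) (H : Matrix (Fin (n - k n)) (Fin n) (ZMod 2))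
        (c : Fin n → ZMod 2) (P : Fin (Niter n) → Pos n (s n))
        (create : Fin (Niter n) → Prog (s n) Unit) (W : Finset (Cell (s n))) (M : Mem (s n)),
        1 ≤ n → 1 ≤ N n →
        IsExecution (k n) (N n) (w n) (Seq n) (Teq n) (e n) H c P create W M →
        ((((rlpn (N n) δ P create).cells M).card : ℝ) ≤ K * (Seq n + 2 ^ s n)) ∧
        (((rlpn (N n) δ P create).time M : ℝ) ≤
          K * (Niter n * (Teq n + (s n + 1) * 2 ^ s n)))) ∧
      ((∀ᶠ n in Filter.atTop, 1 ≤ N n) →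
        (∀ᶠ n in Filter.atTop, 0 < pSucc n (s n) (t n) (u n)) →
        (∃ a : ℕ, (fun n => (Niter n : ℝ)) =O[Filter.atTop] fun n =>
          1 / pSucc n (s n) (t n) (u n) *
            Real.log ((Teq n + 2 ^ s n) / pSucc n (s n) (t n) (u n)) ^ a) →
        ∃ (K : ℝ) (a : ℕ), ∀ᶠ n in Filter.atTop,
          ∀ (δ : ℝ) (H : Matrix (Fin (n - k n)) (Fin n) (ZMod 2))
          (c : Fin n → ZMod 2) (P : Fin (Niter n) → Pos n (s n))
          (create : Fin (Niter n) → Prog (s n) Unit) (W : Finset (Cell (s n))) (M : Mem (s n)),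
          IsExecution (k n) (N n) (w n) (Seq n) (Teq n) (e n) H c P create W M →
          ((rlpn (N n) δ P create).time M : ℝ) ≤
            K * ((Teq n + 2 ^ s n) / pSucc n (s n) (t n) (u n) *
              Real.log ((Teq n + 2 ^ s n) / pSucc n (s n) (t n) (u n)) ^ a))) ∧
    -- correctness
    ((∀ᶠ n in Filter.atTop, |estBias n (s n) (u n) (w n)| < 1) →
      (∀ᶠ n in Filter.atTop,
        (N n : ℝ) ≤ ((n - s n).choose (w n) : ℝ) / (2 : ℝ) ^ ((k n : ℤ) - (s n : ℤ))) →
      IsOmega (fun n => (N n : ℝ))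
        (fun n => (n : ℝ) *
          (((n - s n).choose (w n) : ℝ) / krawtchouk (n - s n) (w n) (u n)) ^ 2) →
      IsOmega (fun n => (Niter n : ℝ)) (fun n => 1 / pSucc n (s n) (t n) (u n)) →
      ∀ M : ∀ n, Mem (s n),
        Filter.Tendsto (fun n =>
          (experiment (hs n) (k n) (N n) (w n) (Niter n) (e n)).toOuterMeasure
            {it | IsCorrect (e n)
              ((rlpnOn (estBias n (s n) (u n) (w n)) it).run (M n)).1})
          Filter.atTop (nhds 1)) := by
  refine ⟨fun n => uniformPos_weightN_eq (hs n) (hut n) (hun n) (he n),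
    fun n δ smp M => iterSpec_load_solve δ smp M, ?_, ?_, ?_⟩
  · rintro n Seq Teq δ H c P create W M ⟨hc, -, hcr, hin⟩
    obtain ⟨h, hh, hd⟩ := rlpn_does δ (e n) hc P create M hcr hin
    exact ⟨h, hh, by rw [hd.post, run_rlpnOn]⟩
  · intro Seq Teq
    refine ⟨⟨40, fun n δ H c P create W M hn hN hex => ?_⟩, fun hN hp ⟨a, hO⟩ => ?_⟩
    · obtain ⟨h1, h2⟩ := space_time_le (δ := δ) (hs n) hn hN hex
      have h3 : ((rlpn (N n) δ P create).cells M).card ≤ 40 * (Seq n + 2 ^ s n) :=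
        h1.trans (Nat.mul_le_mul_right _ (by norm_num))
      exact ⟨by exact_mod_cast h3, by exact_mod_cast h2⟩
    · exact time_isSoftO hs e (fun n => pSucc_le_one (hs n) (hut n) (hun n) (he n)) hN hp hO
  · exact fun hδ hN hX hY M => tendsto_success hk hs hut hun e he hδ hN hX hY M
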